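/- Let $\Gamma$ be the set of edges of the hexagonal lattice in the plane, and let $\mathcal A$ be the quasi-local $C^*$-algebra of a spin system with one copy of $M_2(\mathbb C)$ on each edge $x\in\Gamma$, with Pauli matrices $\sigma^X_x,\sigma^Z_x$. An edge is called occupied if $\sigma^Z_x=-1$. Let $\Omega_0$ be the GNS vector of the pure product state with $\sigma^Z_x=1$ for all $x$. For a finite set $\Pi$ of hexagons let $\partial\Pi$ be the set of edges that lie on exactly one hexagon of $\Pi$, let $A_\Pi=\prod_{x\in\partial\Pi}\sigma^X_x$, and let $\sharp\partial\Pi$ be the number of connected components (loops) of the string configuration $\partial\Pi$. For a finite set $\Lambda$ of hexagons let $\omega_\Lambda$ be the vector state on $\mathcal A$ of $$\Omega_\Lambda=2^{-|\Lambda|/2}\sum_{\Pi\subseteq\Lambda}(-1)^{\sharp\partial\Pi}A_\Pi\Omega_0 .$$ Let $P$ be an oriented closed edge-self-avoiding path in the lattice, that is, either a finite closed loop or an infinite path without endpoints (indexed by $\mathbb Z$). Each vertex $v$ of $P$ has one incoming edge $j$ and one outgoing edge $k$ on $P$; its third edge is the leg at $v$. If the leg lies to the right of $P$ it is an R-leg;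 if it lies to the left, $v$ is an L-vertex. Put $$W_1[P]=\mathbf 1,\qquad W_B[P]=\prod_{\text{R-legs }l}\sigma^Z_l,$$ $$W_S[P]=\Big(\prod_{j\in P}\sigma^X_j\Big)\Big(\prod_{\text{R-legs }l} i^{(1-\sigma^Z_l)/2}\Big)\Big(\prod_{\text{L-vertices }v}(-1)^{s_v}\Big),\qquad s_v=\tfrac14(1-\sigma^Z_j)(1+\sigma^Z_k),$$ and let $W_{\bar S}[P]$ be given by the same formula with $-i$ in place of $i$. Products over R-legs are over the vertices of $P$ whose leg is on the right, so an edge that is the leg of two vertices of $P$ contributes two factors. Let $w_a[P]$ be the automorphism of $\mathcal A$ given by conjugation with $W_a[P]$; for infinite $P$ this unitary is formal, and $w_a[P](O)$ is, for local $O$, the eventually constant value of the conjugations of $O$ by the truncations of $W_a[P]$ to finite sets of indices. Then there is a unique state $\omega$ on $\mathcal A$ (the double semion state) to which $\omega_{\Lambda_n}$ converges in the weak-* topology for every increasing sequence $(\Lambda_n)$ of finite sets of hexagons whose union is the set of all hexagons, and for every closed path $P$, finite or infinite, and every $a\in\{1,S,\bar S,B\}$, $$\omega\circ w_a[P]=\omega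 .$$ -/

import Mathlib

open Filter Topology

namespace DoubleSemion

/-! ### The hexagonal lattice -/

/-- Translations of the hexagonal lattice.  With `d c = exp (2 π i c / 3)`, the pair `(m, n)`
stands for the plane vector `m (d 0 - d 1) + n (d 0 - d 2)`. -/
abbrev Cell : Type := ℤ × ℤ

/-- Vertices.  `(x, false)` sits at the plane vector of `x`, and `(x, true)` is its neighbour
in the direction `d 0`. -/
abbrev Vertex : Type := Cell × Bool

/-- Edges, the sites of the spin system.  `(x, c)` is the edge that leaves the vertex
`(x, false)` in the direction `d c`. -/
abbrev Edge : Type := Cell × Fin 3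

/-- Hexagons.  `x` stands for the hexagon that contains the two edges leaving `(x, false)` in
the directions `d 0` and `d 1`. -/
abbrev Hexagon : Type := Cell

/-- The edge `(x, c)` joins `(x, false)` to `(x + shift c, true)`. -/
def shift (c : Fin 3) : Cell := ![(0, 0), (-1, 0), (0, -1)] c

/-- The neighbour of a vertex along its edge of direction class `c`.  It lies in the direction
`d c` from a vertex `(x, false)` and in the direction `- d c` from a vertex `(x, true)`, so that
around each vertex `c, c + 1, c + 2` is the counterclockwise order of the three edges. -/
def neighbor (v : Vertex) (c : Fin 3) : Vertex :=
  if v.2 then (v.1 - shift c, false) else (v.1 + shift c, true)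

/-- The edge of direction class `c` at a vertex. -/
def edgeAt (v : Vertex) (c : Fin 3) : Edge :=
  if v.2 then (v.1 - shift c, c) else (v.1, c)

/-- The unit vectors `d c` of the plane. -/
noncomputable def unitDir (c : Fin 3) : ℂ :=
  Complex.exp (2 * Real.pi * Complex.I * ((c : ℕ) : ℂ) / 3)

/-- The position of a vertex in the plane. -/
noncomputable def position (v : Vertex) : ℂ :=
  v.1.1 * (unitDir 0 - unitDir 1) + v.1.2 * (unitDir 0 - unitDir 2) +
    if v.2 then unitDir 0 else 0

theorem position_neighbor (v : Vertex) (c : Fin 3) :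
    position (neighbor v c) = position v + (if v.2 then -1 else 1) * unitDir c := by
  obtain ⟨⟨m, n⟩, b⟩ := v
  cases b <;> fin_cases c <;> simp [position, neighbor, shift] <;> ring

/-- The six edges of a hexagon. -/
def hexEdges (h : Hexagon) : Finset Edge :=
  {(h, 0), (h, 1), (h + (0, 1), 1), (h + (0, 1), 2), (h + (-1, 1), 2), (h + (-1, 1), 0)}

/-- `∂Λ`, the edges that lie on exactly one hexagon of `Λ`. -/
def boundary (Λ : Finset Hexagon) : Finset Edge :=
  (Λ.biUnion hexEdges).filter fun e => (Λ.filter fun h => e ∈ hexEdges h).card = 1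

/-- The graph whose vertices are the edges in `S`, joined when they share an endpoint. -/
def stringGraph (S : Finset Edge) : SimpleGraph {e : Edge // e ∈ S} where
  Adj e f := e ≠ f ∧ ∃ (v : Vertex) (c d : Fin 3), edgeAt v c = e ∧ edgeAt v d = f
  symm := ⟨fun _ _ ⟨hne, v, c, d, hc, hd⟩ => ⟨hne.symm, v, d, c, hd, hc⟩⟩
  loopless := ⟨fun _ h => h.1 rfl⟩

/-- The number of connected components of the string configuration `S`. -/
noncomputable def numComponents (S : Finset Edge) : ℕ :=
  Nat.card (stringGraph S).ConnectedComponent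

/-! ### The quasi-local algebra

The algebra is realized in the representation of the product state without strings: its
Hilbert space has the orthonormal basis `|S⟩`, `S` running over the finite sets of occupied
edges.  For a finite set `X` of edges the Pauli operators on `X` generate a copy of the
matrix algebra `⨂_{x ∈ X} M₂(ℂ)`, and the quasi-local algebra is the norm closure of the
union of these. -/

abbrev HilbertSpace : Type := lp (fun _ : Finset Edge => ℂ) 2

/-- The basis vector `|S⟩` in which exactly the edges of `S` are occupied. -/
noncomputable def ket (S : Finset Edge) : HilbertSpace := lp.single 2 S 1

abbrev Op : Type := HilbertSpace →L[ℂ] HilbertSpace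

theorem memlp_monomial (g : Equiv.Perm (Finset Edge)) (ε : Finset Edge → ℂ)
    (hε : ∀ S, ‖ε S‖ = 1) (ψ : HilbertSpace) : Memℓp (fun S => ε S * ψ (g S)) 2 := by
  have h := (lp.memℓp ψ).summable (by norm_num)
  refine memℓp_gen ?_
  have h2 := g.summable_iff.mpr h
  simpa [Function.comp_def, hε] using h2

/-- The isometry `(U ψ)(S) = ε S * ψ (g S)` for an involution `g` and signs `ε`. -/
noncomputable def monomialOp (g : Equiv.Perm (Finset Edge)) (hg : ∀ S, g (g S) = S)
    (ε : Finset Edge → ℂ) (hε : ∀ S, ‖ε S‖ = 1) (hεg : ∀ S, ε S * ε (g S) = 1) :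
    HilbertSpace ≃ₗᵢ[ℂ] HilbertSpace where
  toLinearEquiv := LinearEquiv.ofInvolutive
    { toFun := fun ψ => ⟨fun S => ε S * ψ (g S), memlp_monomial g ε hε ψ⟩
      map_add' := fun ψ φ => by ext S; exact mul_add _ _ _
      map_smul' := fun a ψ => by ext S; exact mul_left_comm _ _ _ }
    (fun ψ => by ext S; simp [hg, ← mul_assoc, hεg])
  norm_map' ψ := by
    rw [lp.norm_eq_tsum_rpow (by norm_num), lp.norm_eq_tsum_rpow (by norm_num)]
    congr 1
    rw [← g.tsum_eq (fun S => ‖ψ S‖ ^ _)]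
    refine tsum_congr fun S => ?_
    change ‖ε S * ψ (g S)‖ ^ _ = _
    rw [norm_mul, hε, one_mul]

theorem monomialOp_apply (g : Equiv.Perm (Finset Edge)) (hg ε hε hεg) (ψ : HilbertSpace)
    (S : Finset Edge) : monomialOp g hg ε hε hεg ψ S = ε S * ψ (g S) := rfl

/-- The spin flip `|S⟩ ↦ |S △ {x}⟩`. -/
noncomputable def flipIso (x : Edge) : HilbertSpace ≃ₗᵢ[ℂ] HilbertSpace :=
  monomialOp ⟨fun S => symmDiff S {x}, fun S => symmDiff S {x}, fun S => by simp,
    fun S => by simp⟩ (fun S => by simp) (fun _ => 1) (by simp) (by simp)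

/-- The operator `|S⟩ ↦ ± |S⟩`, with the sign `-1` when `x ∈ S`. -/
noncomputable def signIso (x : Edge) : HilbertSpace ≃ₗᵢ[ℂ] HilbertSpace :=
  monomialOp (Equiv.refl _) (fun _ => rfl) (fun S => if x ∈ S then -1 else 1)
    (fun S => by split_ifs <;> simp)
    (fun S => by by_cases h : x ∈ S <;> simp [h])

theorem flipIso_apply (x : Edge) (ψ : HilbertSpace) (S : Finset Edge) :
    flipIso x ψ S = ψ (symmDiff S {x}) := by
  simp [flipIso, monomialOp_apply]

theorem signIso_apply (x : Edge) (ψ : HilbertSpace) (S : Finset Edge) :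
    signIso x ψ S = (if x ∈ S then -1 else 1) * ψ S := rfl

noncomputable def opX (x : Edge) : Op := (flipIso x : HilbertSpace →L[ℂ] HilbertSpace)

noncomputable def opZ (x : Edge) : Op := (signIso x : HilbertSpace →L[ℂ] HilbertSpace)

theorem opX_apply (x : Edge) (ψ : HilbertSpace) (S : Finset Edge) :
    opX x ψ S = ψ (symmDiff S {x}) := flipIso_apply x ψ S

theorem opZ_apply (x : Edge) (ψ : HilbertSpace) (S : Finset Edge) :
    opZ x ψ S = (if x ∈ S then -1 else 1) * ψ S := rfl

theorem opX_mul_self (x : Edge) : opX x * opX x = 1 := by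
  ext ψ S
  simp [opX_apply]

theorem opZ_mul_self (x : Edge) : opZ x * opZ x = 1 := by
  ext ψ S
  by_cases h : x ∈ S <;> simp [opZ_apply, h]

theorem star_eq_self_of_involution (e : HilbertSpace ≃ₗᵢ[ℂ] HilbertSpace)
    (h : (e : Op) * (e : Op) = 1) : star (e : Op) = (e : Op) := by
  have h1 : star (e : Op) * (e : Op) = 1 := by
    have := (Unitary.linearIsometryEquiv.symm e).2
    have h2 := Unitary.star_mul_self_of_mem this
    simpa using h2
  calc star (e : Op) = star (e : Op) * ((e : Op) * (e : Op)) := by rw [h, mul_one]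
    _ = e := by rw [← mul_assoc, h1, one_mul]

theorem star_opX (x : Edge) : star (opX x) = opX x :=
  star_eq_self_of_involution _ (opX_mul_self x)

theorem star_opZ (x : Edge) : star (opZ x) = opZ x :=
  star_eq_self_of_involution _ (opZ_mul_self x)

theorem opX_commute (x y : Edge) : Commute (opX x) (opX y) := by
  ext ψ S
  simp only [mul_apply_eq_comp, opX_apply]
  rw [symmDiff_right_comm]

theorem opZ_commute (x y : Edge) : Commute (opZ x) (opZ y) := by
  ext ψ S
  simp only [mul_apply_eq_comp, opZ_apply]
  ring

theorem opZ_commute_opX {x y : Edge} (h : x ≠ y) : Commute (opZ x) (opX y) := by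
  ext ψ S
  simp only [mul_apply_eq_comp, opZ_apply, opX_apply]
  simp [Finset.mem_symmDiff, h]

/-- The algebra of local observables. -/
noncomputable def localAlgebra : StarSubalgebra ℂ Op :=
  StarAlgebra.adjoin ℂ (Set.range opX ∪ Set.range opZ)

/-- The quasi-local algebra. -/
noncomputable abbrev quasiLocalAlgebra : StarSubalgebra ℂ Op := localAlgebra.topologicalClosure

/-- Quasi-local observables. -/
abbrev Obs : Type := quasiLocalAlgebra

/-- The observable is local. -/
def IsLocal (O : Obs) : Prop := (O : Op) ∈ localAlgebra

theorem opX_mem (x : Edge) : opX x ∈ localAlgebra :=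
  StarAlgebra.subset_adjoin ℂ _ (Or.inl ⟨x, rfl⟩)

theorem opZ_mem (x : Edge) : opZ x ∈ localAlgebra :=
  StarAlgebra.subset_adjoin ℂ _ (Or.inr ⟨x, rfl⟩)

/-- The Pauli matrix `σ^X` on the edge `x`. -/
noncomputable def sigmaX (x : Edge) : Obs :=
  ⟨opX x, StarSubalgebra.le_topologicalClosure _ (opX_mem x)⟩

/-- The Pauli matrix `σ^Z` on the edge `x`. -/
noncomputable def sigmaZ (x : Edge) : Obs :=
  ⟨opZ x, StarSubalgebra.le_topologicalClosure _ (opZ_mem x)⟩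

theorem sigmaX_mul_self (x : Edge) : sigmaX x * sigmaX x = 1 := Subtype.ext (opX_mul_self x)
theorem sigmaZ_mul_self (x : Edge) : sigmaZ x * sigmaZ x = 1 := Subtype.ext (opZ_mul_self x)
theorem star_sigmaX (x : Edge) : star (sigmaX x) = sigmaX x := Subtype.ext (star_opX x)
theorem star_sigmaZ (x : Edge) : star (sigmaZ x) = sigmaZ x := Subtype.ext (star_opZ x)
theorem sigmaX_commute (x y : Edge) : Commute (sigmaX x) (sigmaX y) :=
  Subtype.ext (opX_commute x y)
theorem sigmaZ_commute (x y : Edge) : Commute (sigmaZ x) (sigmaZ y) :=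
  Subtype.ext (opZ_commute x y)
theorem sigmaZ_commute_sigmaX {x y : Edge} (h : x ≠ y) : Commute (sigmaZ x) (sigmaX y) :=
  Subtype.ext (opZ_commute_opX h)

/-! ### The double semion state -/

/-- `A_h`, the product of `σ^X` over the edges of a hexagon. -/
noncomputable def hexOp (h : Hexagon) : Obs :=
  (hexEdges h).noncommProd sigmaX fun x _ y _ _ => sigmaX_commute x y

theorem hexOp_commute (h k : Hexagon) : Commute (hexOp h) (hexOp k) :=
  Finset.noncommProd_commute _ _ _ _ fun x _ =>
    (Finset.noncommProd_commute _ _ _ _ fun y _ => sigmaX_commute x y).symm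

/-- `A_Λ`, the product of `A_h` over the hexagons of a finite set. -/
noncomputable def regionOp (Λ : Finset Hexagon) : Obs :=
  Λ.noncommProd hexOp fun h _ k _ _ => hexOp_commute h k

/-- The superposition
`2 ^ (- |Λ| / 2) * ∑_{Π ⊆ Λ} (-1) ^ (number of components of ∂Π) • A_Π |∅⟩`. -/
noncomputable def semionVector (Λ : Finset Hexagon) : HilbertSpace :=
  ((Real.sqrt (1 / 2 ^ Λ.card) : ℝ) : ℂ) •
    ∑ R ∈ Λ.powerset, ((-1 : ℂ) ^ numComponents (boundary R)) • (regionOp R : Op) (ket ∅)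

/-- The vector state `O ↦ ⟪Ω, O Ω⟫` of `Ω = semionVector Λ`. -/
noncomputable def finiteState (Λ : Finset Hexagon) : WeakDual ℂ Obs :=
  StrongDual.toWeakDual
    ((innerSL ℂ (semionVector Λ)) ∘L
      (ContinuousLinearMap.apply ℂ HilbertSpace (semionVector Λ)) ∘L
      quasiLocalAlgebra.toSubalgebra.toSubmodule.subtypeL)

theorem finiteState_apply (Λ : Finset Hexagon) (O : Obs) :
    finiteState Λ O = inner ℂ (semionVector Λ) ((O : Op) (semionVector Λ)) := rfl

/-- The double semion state: the weak-* limit of the states `finiteState Λ` as `Λ` grows to the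
set of all hexagons. -/
noncomputable def doubleSemionState : WeakDual ℂ Obs :=
  limUnder (atTop : Filter (Finset Hexagon)) finiteState

/-! ### Conjugation by formal infinite products -/

/-- The conjugations of a local observable by the unitaries `U F` are eventually constant, with
a local value. -/
def Stabilizes {ι : Type} (U : Finset ι → unitary Obs) : Prop :=
  ∀ O : Obs, IsLocal O → ∃ O' : Obs, IsLocal O' ∧
    ∀ᶠ F in atTop, Unitary.conjStarAlgAut ℂ Obs (U F) O = O'

theorem Stabilizes.mul {ι : Type} {U V : Finset ι → unitary Obs} (hU : Stabilizes U)
    (hV : Stabilizes V) : Stabilizes fun F => U F * V F := by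
  intro O hO
  obtain ⟨O₁, h₁, e₁⟩ := hV O hO
  obtain ⟨O₂, h₂, e₂⟩ := hU O₁ h₁
  refine ⟨O₂, h₂, ?_⟩
  filter_upwards [e₁, e₂] with F f₁ f₂
  rw [map_mul, StarAlgEquiv.mul_apply, f₁, f₂]

theorem dense_local : Dense {O : Obs | IsLocal O} := by
  rw [Metric.dense_iff]
  intro O r hr
  have hO : (O : Op) ∈ closure (localAlgebra : Set Op) := by
    rw [← StarSubalgebra.topologicalClosure_coe]; exact O.2
  obtain ⟨b, hb, hd⟩ := Metric.mem_closure_iff.mp hO r hr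
  refine ⟨⟨b, StarSubalgebra.le_topologicalClosure _ hb⟩, ?_, hb⟩
  rw [Metric.mem_ball, dist_comm]
  exact hd

theorem norm_conj (u : unitary Obs) (O : Obs) : ‖Unitary.conjStarAlgAut ℂ Obs u O‖ = ‖O‖ := by
  rw [Unitary.conjStarAlgAut_apply, CStarRing.norm_mul_mem_unitary _ (Unitary.star_mem u.2),
    CStarRing.norm_mem_unitary_mul _ u.2]

theorem Stabilizes.exists_tendsto {ι : Type} {U : Finset ι → unitary Obs} (hU : Stabilizes U)
    (O : Obs) : ∃ O', Tendsto (fun F => Unitary.conjStarAlgAut ℂ Obs (U F) O) atTop (𝓝 O') := by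
  have : CompleteSpace Obs :=
    (StarSubalgebra.isClosed_topologicalClosure localAlgebra).completeSpace_coe
  classical
  refine cauchy_map_iff_exists_tendsto.mp (Metric.cauchy_iff.mpr ⟨inferInstance, ?_⟩)
  intro r hr
  obtain ⟨L, hL, hd⟩ := Metric.dense_iff.mp dense_local O (r / 3) (by positivity)
  rw [Metric.mem_ball, dist_eq_norm] at hL
  obtain ⟨O', -, e⟩ := hU L hd
  refine ⟨_, Filter.image_mem_map e, ?_⟩
  have key : ∀ F, Unitary.conjStarAlgAut ℂ Obs (U F) L = O' →
      ‖Unitary.conjStarAlgAut ℂ Obs (U F) O - O'‖ < r / 3 := by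
    intro F hF
    rw [← hF, ← map_sub, norm_conj, norm_sub_rev]
    exact hL
  rintro _ ⟨F, hF, rfl⟩ _ ⟨G, hG, rfl⟩
  rw [dist_eq_norm]
  have h1 := key F hF
  have h2 := key G hG
  rw [norm_sub_rev] at h2
  calc _ = ‖(Unitary.conjStarAlgAut ℂ Obs (U F) O - O') +
        (O' - Unitary.conjStarAlgAut ℂ Obs (U G) O)‖ := by rw [sub_add_sub_cancel]
    _ ≤ _ := norm_add_le _ _
    _ < r := by linarith

/-- The limit of the conjugations of `O` by the unitaries `U F`. -/
noncomputable def conjLimit {ι : Type} (U : Finset ι → unitary Obs) (O : Obs) : Obs :=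
  limUnder atTop fun F => Unitary.conjStarAlgAut ℂ Obs (U F) O

theorem Stabilizes.tendsto {ι : Type} {U : Finset ι → unitary Obs} (hU : Stabilizes U)
    (O : Obs) : Tendsto (fun F => Unitary.conjStarAlgAut ℂ Obs (U F) O) atTop
      (𝓝 (conjLimit U O)) :=
  tendsto_nhds_limUnder (hU.exists_tendsto O)

theorem conjLimit_conjLimit {ι : Type} {U V : Finset ι → unitary Obs} (hU : Stabilizes U)
    (hV : Stabilizes V) (hUV : ∀ F, V F * U F = 1) (O : Obs) :
    conjLimit V (conjLimit U O) = O := by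
  classical
  refine tendsto_nhds_unique (hV.tendsto (conjLimit U O)) ?_
  rw [tendsto_iff_norm_sub_tendsto_zero]
  have h := tendsto_iff_norm_sub_tendsto_zero.mp (hU.tendsto O)
  refine h.congr fun F => ?_
  have h1 : Unitary.conjStarAlgAut ℂ Obs (V F) (Unitary.conjStarAlgAut ℂ Obs (U F) O) = O := by
    rw [← StarAlgEquiv.mul_apply, ← map_mul, hUV, map_one]; rfl
  have h2 : Unitary.conjStarAlgAut ℂ Obs (V F) (conjLimit U O) - O =
      Unitary.conjStarAlgAut ℂ Obs (V F)
        (conjLimit U O - Unitary.conjStarAlgAut ℂ Obs (U F) O) := by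
    rw [map_sub, h1]
  rw [h2, norm_conj, norm_sub_rev]

/-- The automorphism `O ↦ lim_F U F * O * (U F)⁻¹`. -/
noncomputable def formalConj {ι : Type} (U : Finset ι → unitary Obs) (hU : Stabilizes U)
    (hU' : Stabilizes fun F => (U F)⁻¹) : Obs ≃⋆ₐ[ℂ] Obs where
  toFun := conjLimit U
  invFun := conjLimit fun F => (U F)⁻¹
  left_inv O := conjLimit_conjLimit hU hU' (fun _ => inv_mul_cancel _) O
  right_inv O := conjLimit_conjLimit hU' hU (fun _ => mul_inv_cancel _) O
  map_mul' O Q := by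
    classical
    refine tendsto_nhds_unique (hU.tendsto (O * Q)) ?_
    simpa only [map_mul] using (hU.tendsto O).mul (hU.tendsto Q)
  map_add' O Q := by
    classical
    refine tendsto_nhds_unique (hU.tendsto (O + Q)) ?_
    simpa only [map_add] using (hU.tendsto O).add (hU.tendsto Q)
  map_star' O := by
    classical
    refine tendsto_nhds_unique (hU.tendsto (star O)) ?_
    simpa only [map_star] using (hU.tendsto O).star
  map_smul' a O := by
    classical
    refine tendsto_nhds_unique (hU.tendsto (a • O)) ?_
    simpa only [map_smul] using (hU.tendsto O).const_smul a

/-- The product of a commuting family of unitaries over a finite index set. -/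
noncomputable def prodFamily {ι : Type} (f : ι → unitary Obs) (hf : ∀ i j, Commute (f i) (f j))
    (F : Finset ι) : unitary Obs :=
  F.noncommProd f fun i _ j _ _ => hf i j

theorem finite_not_commute {ι : Type} (f : ι → unitary Obs)
    (hX : ∀ x, {i | ¬ Commute ((f i : Obs) : Op) (opX x)}.Finite)
    (hZ : ∀ x, {i | ¬ Commute ((f i : Obs) : Op) (opZ x)}.Finite)
    (O : Op) (hO : O ∈ localAlgebra) : {i | ¬ Commute ((f i : Obs) : Op) O}.Finite := by
  induction hO using StarAlgebra.adjoin_induction with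
  | mem g hg =>
    obtain ⟨x, rfl⟩ | ⟨x, rfl⟩ := hg
    · exact hX x
    · exact hZ x
  | algebraMap r =>
    convert Set.finite_empty
    ext i
    simpa using Algebra.commute_algebraMap_right r _
  | add a b _ _ ha hb =>
    refine (ha.union hb).subset fun i hi => ?_
    by_contra hn
    simp only [Set.mem_union, Set.mem_ofPred_eq, not_or, not_not] at hn
    exact hi (hn.1.add_right hn.2)
  | mul a b _ _ ha hb =>
    refine (ha.union hb).subset fun i hi => ?_
    by_contra hn
    simp only [Set.mem_union, Set.mem_ofPred_eq, not_or, not_not] at hn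
    exact hi (hn.1.mul_right hn.2)
  | star a _ ha =>
    refine ha.subset fun i hi hc => hi ?_
    have hu : star ((f i : Obs) : Op) * ((f i : Obs) : Op) = 1 :=
      congrArg Subtype.val (Unitary.coe_star_mul_self (f i))
    have hu' : ((f i : Obs) : Op) * star ((f i : Obs) : Op) = 1 :=
      congrArg Subtype.val (Unitary.coe_mul_star_self (f i))
    have h1 : star a * star ((f i : Obs) : Op) = star ((f i : Obs) : Op) * star a := by
      simpa using congrArg star hc.eq
    calc ((f i : Obs) : Op) * star a
        = ((f i : Obs) : Op) * (star a * star ((f i : Obs) : Op)) * ((f i : Obs) : Op) := by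
          simp only [mul_assoc, hu, mul_one]
      _ = star a * ((f i : Obs) : Op) := by
          rw [h1, ← mul_assoc, hu', one_mul]

theorem isLocal_prodFamily {ι : Type} (f : ι → unitary Obs) (hf : ∀ i j, Commute (f i) (f j))
    (hl : ∀ i, IsLocal (f i)) (F : Finset ι) : IsLocal (prodFamily f hf F) := by
  refine Finset.noncommProd_induction F f _ (fun u : unitary Obs => IsLocal u) ?_ ?_ ?_
  · intro a b ha hb
    exact mul_mem (S := StarSubalgebra ℂ Op) ha hb
  · exact one_mem localAlgebra
  · intro i _
    exact hl i

theorem stabilizes_prodFamily {ι : Type} (f : ι → unitary Obs)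
    (hf : ∀ i j, Commute (f i) (f j)) (hl : ∀ i, IsLocal (f i))
    (hX : ∀ x, {i | ¬ Commute ((f i : Obs) : Op) (opX x)}.Finite)
    (hZ : ∀ x, {i | ¬ Commute ((f i : Obs) : Op) (opZ x)}.Finite) :
    Stabilizes (prodFamily f hf) := by
  classical
  intro O hO
  have hfin := finite_not_commute f hX hZ O hO
  set F₀ := hfin.toFinset with hF₀
  refine ⟨Unitary.conjStarAlgAut ℂ Obs (prodFamily f hf F₀) O, ?_, ?_⟩
  · rw [Unitary.conjStarAlgAut_apply]
    have h := isLocal_prodFamily f hf hl F₀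
    exact mul_mem (S := StarSubalgebra ℂ Op) (mul_mem (S := StarSubalgebra ℂ Op) h hO)
      (star_mem (S := StarSubalgebra ℂ Op) h)
  · filter_upwards [eventually_ge_atTop F₀] with F hF
    have hsplit : prodFamily f hf F = prodFamily f hf F₀ * prodFamily f hf (F \ F₀) := by
      unfold prodFamily
      rw [← Finset.noncommProd_union_of_disjoint Finset.disjoint_sdiff]
      · exact Finset.noncommProd_congr (Finset.union_sdiff_of_subset hF).symm (fun _ _ => rfl) _
    have hcomm : Commute ((prodFamily f hf (F \ F₀) : unitary Obs) : Obs) O := by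
      refine Finset.noncommProd_induction (F \ F₀) f _
        (fun u : unitary Obs => Commute (u : Obs) O) ?_ ?_ ?_
      · intro a b ha hb
        exact ha.mul_left hb
      · exact Commute.one_left O
      · intro i hi
        have hi' : i ∉ F₀ := (Finset.mem_sdiff.mp hi).2
        simp only [hF₀, Set.Finite.mem_toFinset, Set.mem_ofPred_eq, not_not] at hi'
        exact Subtype.ext hi'
    have hfix : Unitary.conjStarAlgAut ℂ Obs (prodFamily f hf (F \ F₀)) O = O := by
      rw [Unitary.conjStarAlgAut_apply, hcomm.eq, mul_assoc, ← Unitary.coe_star,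
        Unitary.coe_mul_star_self, mul_one]
    rw [hsplit, map_mul, StarAlgEquiv.mul_apply, hfix]

/-! ### String operators -/

/-- A closed edge-self-avoiding path: for `n ≥ 1` a closed loop with `n` steps, and for `n = 0`,
where `ZMod 0 = ℤ`, an infinite path without endpoints.  It is oriented by increasing `i`, and
its step `i` leaves `vertex i` along the edge of direction class `dir i`. -/
structure ClosedPath (n : ℕ) where
  vertex : ZMod n → Vertex
  dir : ZMod n → Fin 3
  step : ∀ i, vertex (i + 1) = neighbor (vertex i) (dir i)
  edge_injective : Function.Injective fun i => edgeAt (vertex i) (dir i)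

namespace ClosedPath

variable {n : ℕ} (P : ClosedPath n)

/-- The edge by which the path leaves `vertex i`; it enters `vertex i` by `edge (i - 1)`. -/
def edge (i : ZMod n) : Edge := edgeAt (P.vertex i) (P.dir i)

/-- The leg at `vertex i`: the third edge there, besides `edge (i - 1)` and `edge i`
(the three direction classes sum to zero). -/
def leg (i : ZMod n) : Edge := edgeAt (P.vertex i) (-(P.dir (i - 1) + P.dir i))

/-- The path leaves `vertex i` by the edge next to the incoming one in counterclockwise order
(it turns right), so the leg is on its left. -/
def IsLeft (i : ZMod n) : Prop := P.dir i = P.dir (i - 1) + 1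

/-- The path leaves `vertex i` by the edge next to the incoming one in clockwise order
(it turns left), so the leg is on its right. -/
def IsRight (i : ZMod n) : Prop := P.dir i = P.dir (i - 1) - 1

instance (i : ZMod n) : Decidable (P.IsLeft i) := inferInstanceAs (Decidable (_ = _))

instance (i : ZMod n) : Decidable (P.IsRight i) := inferInstanceAs (Decidable (_ = _))

theorem edgeAt_neighbor (v : Vertex) (c : Fin 3) : edgeAt (neighbor v c) c = edgeAt v c := by
  obtain ⟨x, b⟩ := v
  cases b <;> simp [edgeAt, neighbor]

theorem edge_pred (i : ZMod n) : P.edge (i - 1) = edgeAt (P.vertex i) (P.dir (i - 1)) := by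
  have h := P.step (i - 1)
  rw [sub_add_cancel] at h
  rw [h, edgeAt_neighbor, edge]

theorem isLeft_or_isRight (i : ZMod n) : P.IsLeft i ∨ P.IsRight i := by
  have hne : P.dir i ≠ P.dir (i - 1) := by
    intro h
    have h1 : P.edge i = P.edge (i - 1) := by rw [edge_pred, edge, h]
    have h2 : i = i - 1 := P.edge_injective h1
    have h3 := P.step (i - 1)
    rw [sub_add_cancel, ← h2] at h3
    have h4 := congrArg Prod.snd h3
    revert h4
    cases hb : (P.vertex i).2 <;> simp [neighbor, hb]
  unfold IsLeft IsRight
  generalize P.dir i = a at *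
  generalize P.dir (i - 1) = b at *
  revert a b
  decide

end ClosedPath

/-- `u ^ Q` for an orthogonal projection `Q`. -/
noncomputable def projPow (u : ℂ) (Q : Obs) : Obs := 1 + (u - 1) • Q

theorem projPow_mem_unitary {u : ℂ} (hu : star u * u = 1) {Q : Obs} (hs : star Q = Q)
    (hQ : Q * Q = Q) : projPow u Q ∈ unitary Obs := by
  have key : ∀ a b : ℂ, a * b = 1 → projPow a Q * projPow b Q = 1 := by
    intro a b hab
    have h0 : (a - 1) + (b - 1) + (a - 1) * (b - 1) = 0 := by linear_combination hab
    have h1 : projPow a Q * projPow b Q =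
        1 + ((a - 1) + (b - 1) + (a - 1) * (b - 1)) • Q := by
      simp only [projPow, mul_add, add_mul, one_mul, mul_one, smul_mul_smul_comm, hQ, add_smul]
      abel
    rw [h1, h0, zero_smul, add_zero]
  have hstar : star (projPow u Q) = projPow (star u) Q := by
    simp [projPow, hs]
  rw [Unitary.mem_iff, hstar]
  exact ⟨key _ _ hu, key _ _ (by rw [mul_comm]; exact hu)⟩

theorem projPow_isLocal (u : ℂ) {Q : Obs} (hQ : IsLocal Q) : IsLocal (projPow u Q) :=
  add_mem (S := StarSubalgebra ℂ Op) (one_mem localAlgebra) (SMulMemClass.smul_mem (u - 1) hQ)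

theorem projPow_commute (u : ℂ) {Q O : Obs} (h : Commute Q O) : Commute (projPow u Q) O :=
  (Commute.one_left O).add_left (h.smul_left (u - 1))

/-- The projection `(1 - σ^Z) / 2` onto occupied edges. -/
noncomputable def occupied (x : Edge) : Obs := (1 / 2 : ℂ) • (1 - sigmaZ x)

/-- The projection `s = (1 - σ_j^Z) (1 + σ_k^Z) / 4`. -/
noncomputable def cornerProj (j k : Edge) : Obs :=
  (1 / 4 : ℂ) • ((1 - sigmaZ j) * (1 + sigmaZ k))

theorem star_occupied (x : Edge) : star (occupied x) = occupied x := by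
  simp [occupied, star_sigmaZ]

theorem occupied_mul_self (x : Edge) : occupied x * occupied x = occupied x := by
  have h : (1 - sigmaZ x) * (1 - sigmaZ x) = (2 : ℂ) • (1 - sigmaZ x) := by
    rw [mul_sub, sub_mul, sub_mul, sigmaZ_mul_self, two_smul]
    simp only [one_mul, mul_one]
    abel
  rw [occupied, smul_mul_smul_comm, h, smul_smul]
  norm_num

theorem cornerProj_eq (j k : Edge) : cornerProj j k = occupied j * (1 - occupied k) := by
  have h : (1 : Obs) - occupied k = (1 / 2 : ℂ) • (1 + sigmaZ k) := by
    have h1 : (1 : Obs) = (1 / 2 : ℂ) • (1 : Obs) + (1 / 2 : ℂ) • (1 : Obs) := by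
      rw [← add_smul]; norm_num
    rw [occupied, smul_sub, smul_add]
    nth_rewrite 1 [h1]
    abel
  rw [h, occupied, smul_mul_smul_comm, cornerProj]
  norm_num

theorem occupied_commute {x : Edge} {O : Obs} (h : Commute (sigmaZ x) O) :
    Commute (occupied x) O :=
  ((Commute.one_left O).sub_left h).smul_left _

theorem cornerProj_commute {j k : Edge} {O : Obs} (hj : Commute (sigmaZ j) O)
    (hk : Commute (sigmaZ k) O) : Commute (cornerProj j k) O := by
  rw [cornerProj_eq]
  exact (occupied_commute hj).mul_left ((Commute.one_left O).sub_left (occupied_commute hk))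

theorem occupied_isLocal (x : Edge) : IsLocal (occupied x) :=
  SMulMemClass.smul_mem (1 / 2 : ℂ) (sub_mem (one_mem localAlgebra) (opZ_mem x))

theorem cornerProj_isLocal (j k : Edge) : IsLocal (cornerProj j k) := by
  rw [cornerProj_eq]
  exact mul_mem (S := StarSubalgebra ℂ Op) (occupied_isLocal j)
    (sub_mem (one_mem localAlgebra) (occupied_isLocal k))

theorem star_cornerProj (j k : Edge) : star (cornerProj j k) = cornerProj j k := by
  have h : Commute (occupied j) (1 - occupied k) :=
    (Commute.one_right _).sub_right
      (occupied_commute (occupied_commute (sigmaZ_commute k j)).symm)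
  rw [cornerProj_eq, star_mul, star_sub, star_one, star_occupied, star_occupied, h.eq]

theorem cornerProj_mul_self (j k : Edge) :
    cornerProj j k * cornerProj j k = cornerProj j k := by
  have h : Commute (occupied j) (1 - occupied k) :=
    (Commute.one_right _).sub_right
      (occupied_commute (occupied_commute (sigmaZ_commute k j)).symm)
  have h2 : (1 - occupied k) * (1 - occupied k) = 1 - occupied k := by
    rw [mul_sub, sub_mul, sub_mul, occupied_mul_self]
    simp
  rw [cornerProj_eq, mul_assoc, ← mul_assoc (1 - occupied k), ← h.eq, mul_assoc, h2,
    ← mul_assoc, occupied_mul_self]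

/-- `σ_x^X` as a unitary. -/
noncomputable def unitX (x : Edge) : unitary Obs :=
  ⟨sigmaX x, by rw [Unitary.mem_iff, star_sigmaX]; exact ⟨sigmaX_mul_self x, sigmaX_mul_self x⟩⟩

/-- `σ_x^Z` as a unitary. -/
noncomputable def unitZ (x : Edge) : unitary Obs :=
  ⟨sigmaZ x, by rw [Unitary.mem_iff, star_sigmaZ]; exact ⟨sigmaZ_mul_self x, sigmaZ_mul_self x⟩⟩

/-- `u ^ ((1 - σ_x^Z) / 2)` as a unitary, for a complex phase `u`. -/
noncomputable def unitPhase (u : unitary ℂ) (x : Edge) : unitary Obs :=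
  ⟨projPow u (occupied x), projPow_mem_unitary (Unitary.coe_star_mul_self u) (star_occupied x)
    (occupied_mul_self x)⟩

/-- `(-1) ^ s` with `s = (1 - σ_j^Z) (1 + σ_k^Z) / 4` as a unitary. -/
noncomputable def unitCorner (j k : Edge) : unitary Obs :=
  ⟨projPow (-1) (cornerProj j k), projPow_mem_unitary (by simp) (star_cornerProj j k)
    (cornerProj_mul_self j k)⟩

/-- The imaginary unit as a phase. -/
noncomputable def phaseI : unitary ℂ := ⟨Complex.I, by rw [Unitary.mem_iff]; simp⟩

namespace ClosedPath

variable {n : ℕ} (P : ClosedPath n)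

/-- The factor `σ^X` of the edge `i`. -/
noncomputable def flipFactor (i : ZMod n) : unitary Obs := unitX (P.edge i)

/-- The factor of an R-leg. A leg that joins two vertices of the path contributes a factor for
each of them. -/
noncomputable def legFactor (f : Edge → unitary Obs) (i : ZMod n) : unitary Obs :=
  if P.IsRight i then f (P.leg i) else 1

/-- The factor of an L-vertex. -/
noncomputable def cornerFactor (i : ZMod n) : unitary Obs :=
  if P.IsLeft i then unitCorner (P.edge (i - 1)) (P.edge i) else 1

end ClosedPath

theorem commute_unitary {u v : unitary Obs} (h : Commute (u : Obs) (v : Obs)) : Commute u v :=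
  Subtype.ext h

theorem commute_op {O Q : Obs} (h : Commute O Q) : Commute (O : Op) (Q : Op) :=
  congrArg Subtype.val h

namespace ClosedPath

variable {n : ℕ} (P : ClosedPath n)

theorem flipFactor_commute (i j : ZMod n) : Commute (P.flipFactor i) (P.flipFactor j) :=
  commute_unitary (sigmaX_commute _ _)

theorem legFactor_commute (f : Edge → unitary Obs) (hf : ∀ x y, Commute (f x) (f y))
    (i j : ZMod n) : Commute (P.legFactor f i) (P.legFactor f j) := by
  unfold legFactor
  split_ifs
  · exact hf _ _
  · exact Commute.one_right _
  · exact Commute.one_left _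
  · exact Commute.one_left _

theorem cornerFactor_commute (i j : ZMod n) :
    Commute (P.cornerFactor i) (P.cornerFactor j) := by
  unfold cornerFactor
  split_ifs
  · refine commute_unitary (projPow_commute _ (projPow_commute _ ?_).symm)
    exact cornerProj_commute
      (cornerProj_commute (sigmaZ_commute _ _) (sigmaZ_commute _ _)).symm
      (cornerProj_commute (sigmaZ_commute _ _) (sigmaZ_commute _ _)).symm
  · exact Commute.one_right _
  · exact Commute.one_left _
  · exact Commute.one_left _

end ClosedPath

theorem prodFamily_inv {ι : Type} (f : ι → unitary Obs) (hf : ∀ i j, Commute (f i) (f j))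
    (F : Finset ι) : (prodFamily f hf F)⁻¹ =
      prodFamily (fun i => (f i)⁻¹) (fun i j => (hf i j).inv_inv) F := by
  rw [inv_eq_iff_mul_eq_one]
  refine (Finset.noncommProd_mul_distrib (s := F) f (fun i => (f i)⁻¹)
    (fun i _ j _ _ => hf i j) (fun i _ j _ _ => (hf i j).inv_inv)
    (fun i _ j _ _ => (hf i j).inv_left)).symm.trans ?_
  rw [Finset.noncommProd_eq_pow_card _ _ _ 1 (fun i _ => by simp), one_pow]

theorem stabilizes_prodFamily_inv {ι : Type} (f : ι → unitary Obs)
    (hf : ∀ i j, Commute (f i) (f j)) (hl : ∀ i, IsLocal (f i))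
    (hX : ∀ x, {i | ¬ Commute ((f i : Obs) : Op) (opX x)}.Finite)
    (hZ : ∀ x, {i | ¬ Commute ((f i : Obs) : Op) (opZ x)}.Finite) :
    Stabilizes fun F => (prodFamily f hf F)⁻¹ := by
  simp only [prodFamily_inv]
  have hc : ∀ (i : ι) (A : Op), star A = A → Commute ((f i : Obs) : Op) A →
      Commute (((f i)⁻¹ : unitary Obs) : Op) A := by
    intro i A hA h
    have h1 := congrArg star h.eq
    rw [star_mul, star_mul, hA] at h1
    exact h1.symm
  refine stabilizes_prodFamily _ _ (fun i => ?_) (fun x => ?_) (fun x => ?_)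
  · exact star_mem (S := StarSubalgebra ℂ Op) (hl i)
  · exact (hX x).subset fun i hi h => hi (hc i _ (star_opX x) h)
  · exact (hZ x).subset fun i hi h => hi (hc i _ (star_opZ x) h)

theorem unitPhase_commute (u : unitary ℂ) (x y : Edge) :
    Commute (unitPhase u x) (unitPhase u y) :=
  commute_unitary (projPow_commute _ (projPow_commute _
    (occupied_commute (occupied_commute (sigmaZ_commute x y)).symm)).symm)

theorem unitZ_commute (x y : Edge) : Commute (unitZ x) (unitZ y) :=
  commute_unitary (sigmaZ_commute x y)

namespace ClosedPath

variable {n : ℕ} (P : ClosedPath n)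

theorem edge_injective' : Function.Injective P.edge := P.edge_injective

theorem finite_edge_pred (x : Edge) : {i | P.edge (i - 1) = x}.Finite :=
  (Set.finite_singleton x).preimage (f := fun i => P.edge (i - 1))
    (fun _ _ _ _ h => sub_left_injective (P.edge_injective' h))

theorem finite_edge (x : Edge) : {i | P.edge i = x}.Finite :=
  (Set.finite_singleton x).preimage (f := P.edge) P.edge_injective'.injOn

theorem edgeAt_eq (v : Vertex) (c : Fin 3) (x : Edge) (h : edgeAt v c = x) :
    v = (x.1, false) ∨ v = (x.1 + shift x.2, true) := by
  subst h
  obtain ⟨y, b⟩ := v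
  cases b <;> simp [edgeAt]

theorem finite_leg (x : Edge) : {i | P.leg i = x}.Finite := by
  let E : Set Edge := Set.range (edgeAt (x.1, false)) ∪ Set.range (edgeAt (x.1 + shift x.2, true))
  have hE : E.Finite := (Set.finite_range _).union (Set.finite_range _)
  refine (hE.preimage (f := P.edge) P.edge_injective'.injOn).subset fun i hi => ?_
  rcases edgeAt_eq _ _ _ hi with h | h
  · exact Or.inl ⟨P.dir i, by rw [edge, h]⟩
  · exact Or.inr ⟨P.dir i, by rw [edge, h]⟩

/-- `∏ σ_j^X` over the edges `j` of the path with indices in `F`. -/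
noncomputable def flipProd : Finset (ZMod n) → unitary Obs :=
  prodFamily P.flipFactor P.flipFactor_commute

/-- `∏ u ^ ((1 - σ_j^Z) / 2)` over the R-legs `j` at vertices with indices in `F`. -/
noncomputable def legPhaseProd (u : unitary ℂ) : Finset (ZMod n) → unitary Obs :=
  prodFamily (P.legFactor (unitPhase u))
    (P.legFactor_commute (unitPhase u) (unitPhase_commute u))

/-- `∏ σ_j^Z` over the R-legs `j` at vertices with indices in `F`. -/
noncomputable def legSignProd : Finset (ZMod n) → unitary Obs :=
  prodFamily (P.legFactor unitZ) (P.legFactor_commute unitZ unitZ_commute)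

/-- `∏ (-1) ^ (s_v)` over the L-vertices `v` with indices in `F`. -/
noncomputable def cornerProd : Finset (ZMod n) → unitary Obs :=
  prodFamily P.cornerFactor P.cornerFactor_commute

theorem stabilizes_flipProd :
    Stabilizes P.flipProd ∧ Stabilizes fun F => (P.flipProd F)⁻¹ := by
  have hl : ∀ i, IsLocal (P.flipFactor i) := fun i => opX_mem _
  have hX : ∀ x, {i | ¬ Commute ((P.flipFactor i : Obs) : Op) (opX x)}.Finite := fun x =>
    Set.finite_empty.subset fun i hi => hi (opX_commute _ _)
  have hZ : ∀ x, {i | ¬ Commute ((P.flipFactor i : Obs) : Op) (opZ x)}.Finite := fun x =>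
    (P.finite_edge x).subset fun i hi => by
      by_contra hne
      exact hi (opZ_commute_opX (Ne.symm hne)).symm
  exact ⟨stabilizes_prodFamily _ _ hl hX hZ, stabilizes_prodFamily_inv _ _ hl hX hZ⟩

theorem stabilizes_leg (f : Edge → unitary Obs) (hf : ∀ x y, Commute (f x) (f y))
    (hl : ∀ x, IsLocal (f x)) (hZ : ∀ x y, Commute (f x : Obs) (sigmaZ y))
    (hX : ∀ x y, x ≠ y → Commute (f x : Obs) (sigmaX y)) :
    Stabilizes (prodFamily (P.legFactor f) (P.legFactor_commute f hf)) ∧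
      Stabilizes fun F => (prodFamily (P.legFactor f) (P.legFactor_commute f hf) F)⁻¹ := by
  have hl' : ∀ i, IsLocal (P.legFactor f i) := fun i => by
    unfold legFactor
    split_ifs
    · exact hl _
    · exact one_mem localAlgebra
  have hX' : ∀ x, {i | ¬ Commute ((P.legFactor f i : Obs) : Op) (opX x)}.Finite := fun x =>
    (P.finite_leg x).subset fun i hi => by
      by_contra hne
      refine hi ?_
      unfold legFactor
      split_ifs
      · exact commute_op (hX _ x hne)
      · exact Commute.one_left _
  have hZ' : ∀ x, {i | ¬ Commute ((P.legFactor f i : Obs) : Op) (opZ x)}.Finite := fun x =>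
    Set.finite_empty.subset fun i hi => by
      refine hi ?_
      unfold legFactor
      split_ifs
      · exact commute_op (hZ _ x)
      · exact Commute.one_left _
  exact ⟨stabilizes_prodFamily _ _ hl' hX' hZ', stabilizes_prodFamily_inv _ _ hl' hX' hZ'⟩

theorem stabilizes_legPhaseProd (u : unitary ℂ) :
    Stabilizes (P.legPhaseProd u) ∧ Stabilizes fun F => (P.legPhaseProd u F)⁻¹ :=
  P.stabilizes_leg (unitPhase u) (unitPhase_commute u) (fun x => projPow_isLocal _ (occupied_isLocal x))
    (fun x y => projPow_commute _ (occupied_commute (sigmaZ_commute x y)))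
    (fun _ _ h => projPow_commute _ (occupied_commute (sigmaZ_commute_sigmaX h)))

theorem stabilizes_legSignProd :
    Stabilizes P.legSignProd ∧ Stabilizes fun F => (P.legSignProd F)⁻¹ :=
  P.stabilizes_leg unitZ unitZ_commute opZ_mem sigmaZ_commute (fun _ _ h => sigmaZ_commute_sigmaX h)

theorem stabilizes_cornerProd :
    Stabilizes P.cornerProd ∧ Stabilizes fun F => (P.cornerProd F)⁻¹ := by
  have hl : ∀ i, IsLocal (P.cornerFactor i) := fun i => by
    unfold cornerFactor
    split_ifs
    · exact projPow_isLocal _ (cornerProj_isLocal _ _)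
    · exact one_mem localAlgebra
  have hX : ∀ x, {i | ¬ Commute ((P.cornerFactor i : Obs) : Op) (opX x)}.Finite := fun x =>
    ((P.finite_edge x).union (P.finite_edge_pred x)).subset fun i hi => by
      by_contra hne
      simp only [Set.mem_union, Set.mem_ofPred_eq, not_or] at hne
      refine hi ?_
      unfold cornerFactor
      split_ifs
      · exact commute_op (projPow_commute _ (cornerProj_commute
          (sigmaZ_commute_sigmaX hne.2) (sigmaZ_commute_sigmaX hne.1)))
      · exact Commute.one_left _
  have hZ : ∀ x, {i | ¬ Commute ((P.cornerFactor i : Obs) : Op) (opZ x)}.Finite := fun x =>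
    Set.finite_empty.subset fun i hi => by
      refine hi ?_
      unfold cornerFactor
      split_ifs
      · exact commute_op (projPow_commute _ (cornerProj_commute
          (sigmaZ_commute _ _) (sigmaZ_commute _ _)))
      · exact Commute.one_left _
  exact ⟨stabilizes_prodFamily _ _ hl hX hZ, stabilizes_prodFamily_inv _ _ hl hX hZ⟩

end ClosedPath

/-- The labels `1, S, S̄, B`. -/
inductive Label : Type
  | vacuum
  | semion
  | antisemion
  | boundState

namespace ClosedPath

variable {n : ℕ} (P : ClosedPath n)

/-- The string operator `W_a[P]`, with all products restricted to the indices in the finite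
set `F`. -/
noncomputable def stringOp (a : Label) (F : Finset (ZMod n)) : unitary Obs :=
  match a with
  | .vacuum => 1
  | .semion => P.flipProd F * P.legPhaseProd phaseI F * P.cornerProd F
  | .antisemion => P.flipProd F * P.legPhaseProd (star phaseI) F * P.cornerProd F
  | .boundState => P.legSignProd F

theorem stabilizes_stringOp (a : Label) :
    Stabilizes (P.stringOp a) ∧ Stabilizes fun F => (P.stringOp a F)⁻¹ := by
  cases a with
  | vacuum =>
    have h : Stabilizes fun _ : Finset (ZMod n) => (1 : unitary Obs) := fun O hO =>
      ⟨O, hO, Eventually.of_forall fun F => by simp⟩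
    exact ⟨h, by simpa [stringOp] using h⟩
  | semion =>
    refine ⟨(P.stabilizes_flipProd.1.mul (P.stabilizes_legPhaseProd _).1).mul
      P.stabilizes_cornerProd.1, ?_⟩
    have h := P.stabilizes_cornerProd.2.mul
      ((P.stabilizes_legPhaseProd phaseI).2.mul P.stabilizes_flipProd.2)
    simpa only [stringOp, mul_inv_rev] using h
  | antisemion =>
    refine ⟨(P.stabilizes_flipProd.1.mul (P.stabilizes_legPhaseProd _).1).mul
      P.stabilizes_cornerProd.1, ?_⟩
    have h := P.stabilizes_cornerProd.2.mul
      ((P.stabilizes_legPhaseProd (star phaseI)).2.mul P.stabilizes_flipProd.2)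
    simpa only [stringOp, mul_inv_rev] using h
  | boundState => exact P.stabilizes_legSignProd

/-- The string automorphism `w_a[P]`: conjugation by the formal unitary `W_a[P]`, that is
`O ↦ lim_F W_F * O * W_F⁻¹` with `W_F = P.stringOp a F`. For a local `O` the right-hand side is
constant for all large `F`. -/
noncomputable def stringAut (a : Label) : Obs ≃⋆ₐ[ℂ] Obs :=
  formalConj (P.stringOp a) (P.stabilizes_stringOp a).1 (P.stabilizes_stringOp a).2

end ClosedPath

end DoubleSemion

/-! The sign `(-1) ^ numComponents (boundary R)` looks global, but it changes by a local rule when a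
hexagon is added to `R`. Walking along `∂R` with `R` on the left is a permutation of the vertices.
The lattice is bipartite, so each loop is a cycle of even length and contributes `-1` to the sign of
this permutation; hence the sign of the permutation is the loop sign (`sign_nextPerm`). Adding a
hexagon `h` multiplies the permutation by one that moves only the six vertices of `h` and depends
only on which neighbours of `h` lie in `R`. Its sign is minus `u` to the number of occupied legs of
`h`, for either root `u` of `u * u = -1` (`loopSign_symmDiff`).

Every local observable is a combination of monomial operators `|C⟩ ↦ g C |C △ A⟩`. The state of such
an operator vanishes unless `A` bounds a region, and then it is the average over `R ⊆ Λ` of a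
function which, by the local rule, sees only finitely many hexagons. It is therefore constant for
large `Λ`, and density of the local observables with the uniform bound `‖finiteState Λ O‖ ≤ ‖O‖`
gives the limit state (`tendsto_finiteState`).

For invariance, the edges of a closed path meet every vertex an even number of times. Since the
plane has no nontrivial cycles, on any finite set of edges they agree with the boundary of a finite
region `Q`, even for an infinite path (`exists_boundary_eqOn`). Replacing `R` by `R △ Q` in the
average undoes the flip along the path where the observable can see it. What remains is to show that
the phase picked up by exchanging the string with a region `S` equals the ratio of loop signs
`exchangeSign Q S R`. By induction on `S` this is needed for one hexagon only
(`finprod_vertexPhase`). There the change of phase at each vertex of the path is the change that the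
flip causes in the leg phase of the hexagon at this vertex, times a quotient of contributions of the
outgoing and the incoming edge (`vertex_exchange`); these quotients telescope because the path has
no endpoints.

The argument works for `u = i` and `u = -i`, which covers `S` and `S̄`. The phases of `B` are the
quotients of the two, so its exchange phase is trivial. -/

namespace DoubleSemion

/-! ### Components of a graph as cycles of a permutation -/

/-- If a permutation `σ` realizes the adjacency of `G` through a bijection onto its support,
then the components of `G` correspond to the cycles of `σ`. -/
theorem card_connectedComponent_eq_card_cycleFactors {α γ : Type*} [Fintype α] [DecidableEq α]
    (G : SimpleGraph γ) (σ : Equiv.Perm α) (t : γ → α) (ht : Function.Injective t)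
    (hsupp : ∀ a, σ a ≠ a ↔ a ∈ Set.range t)
    (hadj : ∀ x y, G.Adj x y ↔ t y = σ (t x) ∨ t x = σ (t y)) :
    Nat.card G.ConnectedComponent = σ.cycleFactorsFinset.card := by
  have hs : ∀ x, t x ∈ σ.support := fun x => by
    rw [Equiv.Perm.mem_support]; exact (hsupp _).2 ⟨x, rfl⟩
  have hstep : ∀ x y, G.Adj x y → σ.cycleOf (t x) = σ.cycleOf (t y) := by
    intro x y h
    rw [← Equiv.Perm.sameCycle_iff_cycleOf_eq_of_mem_support (hs x) (hs y)]
    rcases (hadj x y).1 h with h | h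
    · rw [h, Equiv.Perm.sameCycle_apply_right]
    · rw [h, Equiv.Perm.sameCycle_apply_left]
  have hwalk : ∀ (x y : γ) (p : G.Walk x y), σ.cycleOf (t x) = σ.cycleOf (t y) := by
    intro x y p
    induction p with
    | nil => rfl
    | cons h _ ih => rw [hstep _ _ h, ih]
  -- All iterates of a support point stay in the support, hence in the range of `t`, so an orbit is
  -- a walk in `G`. Natural powers suffice because the support is finite.
  have hpow : ∀ (n : ℕ) (x y : γ), (σ ^ n) (t x) = t y → G.Reachable x y := by
    intro n
    induction n with
    | zero =>
      intro x y h
      have : x = y := ht (by simpa using h)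
      rw [this]
    | succ n ih =>
      intro x y h
      have hmem : (σ ^ n) (t x) ∈ σ.support := by
        rw [Equiv.Perm.pow_apply_mem_support]; exact hs x
      obtain ⟨z, hz⟩ := (hsupp _).1 (Equiv.Perm.mem_support.1 hmem)
      rw [pow_succ', Equiv.Perm.mul_apply, ← hz] at h
      exact (ih x z hz.symm).trans ((hadj z y).2 (Or.inl h.symm)).reachable
  let f : G.ConnectedComponent → σ.cycleFactorsFinset :=
    SimpleGraph.ConnectedComponent.lift
      (fun x => ⟨σ.cycleOf (t x), Equiv.Perm.cycleOf_mem_cycleFactorsFinset_iff.2 (hs x)⟩)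
      (fun x y p _ => Subtype.ext (hwalk x y p))
  have hf : Function.Bijective f := by
    constructor
    · intro c d
      induction c using SimpleGraph.ConnectedComponent.ind with | _ x
      induction d using SimpleGraph.ConnectedComponent.ind with | _ y
      intro h
      have h1 : σ.cycleOf (t x) = σ.cycleOf (t y) := congrArg Subtype.val h
      rw [← Equiv.Perm.sameCycle_iff_cycleOf_eq_of_mem_support (hs x) (hs y)] at h1
      obtain ⟨n, -, hn⟩ := h1.exists_pow_eq'
      exact SimpleGraph.ConnectedComponent.sound (hpow n x y hn)
    · rintro ⟨c, hc⟩
      obtain ⟨a, ha⟩ := ((Equiv.Perm.mem_cycleFactorsFinset_iff.1 hc).1).nonempty_support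
      have ha' := Equiv.Perm.mem_cycleFactorsFinset_support_le hc ha
      obtain ⟨x, hx⟩ := (hsupp a).1 (Equiv.Perm.mem_support.1 ha')
      refine ⟨G.connectedComponentMk x, Subtype.ext ?_⟩
      change σ.cycleOf (t x) = c
      rw [hx, ← Equiv.Perm.cycle_is_cycleOf ha hc]
  rw [Nat.card_congr (Equiv.ofBijective f hf), Nat.card_eq_fintype_card, Fintype.card_coe]

/-- A permutation that exchanges the two colours on its support has the sign
`(-1) ^ (number of nontrivial cycles)`. -/
theorem sign_eq_neg_one_pow_card_cycleFactors {α : Type*} [Fintype α] [DecidableEq α]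
    (σ : Equiv.Perm α) (col : α → Bool) (hcol : ∀ a, σ a ≠ a → col (σ a) = !col a) :
    ((Equiv.Perm.sign σ : ℤˣ) : ℤ) = (-1) ^ σ.cycleFactorsFinset.card := by
  have heq : (σ.support.filter fun a => col a = true).card =
      (σ.support.filter fun a => ¬ col a = true).card := by
    refine Finset.card_bij (fun a _ => σ a) ?_ (fun _ _ _ _ h => σ.injective h) ?_
    · intro a ha
      simp only [Finset.mem_filter, Equiv.Perm.mem_support] at ha ⊢
      refine ⟨fun h => ha.1 (σ.injective h), ?_⟩
      rw [hcol a ha.1, ha.2]; simp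
    · intro b hb
      simp only [Finset.mem_filter, Equiv.Perm.mem_support] at hb
      have h1 : σ (σ.symm b) ≠ σ.symm b := by
        rw [Equiv.apply_symm_apply]
        intro h
        apply hb.1
        nth_rewrite 1 [h]
        exact σ.apply_symm_apply b
      refine ⟨σ.symm b, ?_, σ.apply_symm_apply b⟩
      simp only [Finset.mem_filter, Equiv.Perm.mem_support]
      refine ⟨h1, ?_⟩
      have h2 := hcol _ h1
      rw [Equiv.apply_symm_apply] at h2
      cases h3 : col (σ.symm b)
      · rw [h3] at h2; exact absurd h2 hb.2
      · rfl
  have hcard : σ.support.card = (σ.support.filter fun a => col a = true).card +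
      (σ.support.filter fun a => col a = true).card := by
    conv_rhs => rw [heq]; arg 1; rw [← heq]
    exact (Finset.card_filter_add_card_filter_not _).symm
  -- The sign is `(-1)` to the size of the support plus the number of cycles, and the support has
  -- just been split into two halves of equal size.
  rw [Equiv.Perm.sign_of_cycleType, Equiv.Perm.sum_cycleType, pow_add, hcard, ← two_mul]
  simp [Equiv.Perm.cycleType_def]

/-! ### Sectors at a vertex -/

/-- The hexagon between the edges of classes `c` and `c + 1` at a vertex. -/
def sector (v : Vertex) (c : Fin 3) : Hexagon :=
  v.1 + if v.2 then ![(1, -1), (1, 0), (0, 0)] c else ![(0, 0), (0, -1), (1, -1)] c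

theorem fin3_cases (c d : Fin 3) : d = c ∨ d = c + 1 ∨ d = c + 2 := by
  revert c d; decide

theorem edgeAt_mem_hexEdges (v : Vertex) (c : Fin 3) (h : Hexagon) :
    edgeAt v c ∈ hexEdges h ↔ h = sector v c ∨ h = sector v (c + 2) := by
  obtain ⟨⟨m, n⟩, b⟩ := v
  obtain ⟨p, q⟩ := h
  cases b <;> fin_cases c <;> simp [edgeAt, hexEdges, sector, shift] <;> omega

theorem sector_injective (v : Vertex) : Function.Injective (sector v) := by
  intro c d h
  simp only [sector, add_right_inj] at h
  revert h
  generalize v.2 = b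
  revert b c d
  decide

/-- From the two ends of an edge the left and the right side are interchanged. Together with
`sector_neighbor'` this is what moves statements along an edge. -/
theorem sector_neighbor (v : Vertex) (c : Fin 3) : sector (neighbor v c) (c + 2) = sector v c := by
  obtain ⟨⟨m, n⟩, b⟩ := v
  cases b <;> fin_cases c <;> simp [sector, neighbor, shift]

theorem neighbor_neighbor (v : Vertex) (c : Fin 3) : neighbor (neighbor v c) c = v := by
  obtain ⟨x, b⟩ := v
  cases b <;> simp [neighbor]

theorem sector_neighbor' (v : Vertex) (c : Fin 3) :
    sector (neighbor v c) c = sector v (c + 2) := by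
  have h := sector_neighbor (neighbor v c) c
  rw [neighbor_neighbor] at h
  exact h.symm

theorem neighbor_snd (v : Vertex) (c : Fin 3) : (neighbor v c).2 = !v.2 := by
  obtain ⟨x, b⟩ := v
  cases b <;> simp [neighbor]

theorem edge_eq_edgeAt (e : Edge) : e = edgeAt (e.1, false) e.2 := rfl

/-- The endpoints of an edge. -/
theorem edgeAt_eq_edgeAt_iff (v w : Vertex) (c d : Fin 3) :
    edgeAt v c = edgeAt w d ↔ c = d ∧ (v = w ∨ v = neighbor w d) := by
  obtain ⟨x, b⟩ := v
  obtain ⟨y, b'⟩ := w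
  cases b <;> cases b' <;> simp [edgeAt, neighbor, Prod.ext_iff] <;> grind

/-- An edge lies on just two hexagons, so lying on exactly one hexagon of `R` is an exclusive or.
This makes `boundary` linear over `ZMod 2`. -/
theorem mem_boundary (R : Finset Hexagon) (v : Vertex) (c : Fin 3) :
    edgeAt v c ∈ boundary R ↔ ¬ (sector v c ∈ R ↔ sector v (c + 2) ∈ R) := by
  have hne : sector v c ≠ sector v (c + 2) := fun h => by
    exact absurd (sector_injective v h) (by clear h; revert c; decide)
  have hf : (R.filter fun h => edgeAt v c ∈ hexEdges h) =
      ({sector v c, sector v (c + 2)} : Finset Hexagon).filter (· ∈ R) := by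
    ext h
    simp only [Finset.mem_filter, edgeAt_mem_hexEdges, Finset.mem_insert, Finset.mem_singleton]
    tauto
  rw [boundary, Finset.mem_filter, hf, Finset.mem_biUnion]
  by_cases h1 : sector v c ∈ R <;> by_cases h2 : sector v (c + 2) ∈ R <;>
    simp [Finset.filter_insert, Finset.filter_singleton, h1, h2, hne]
  · exact ⟨_, _, h1, (edgeAt_mem_hexEdges v c _).2 (Or.inl rfl)⟩
  · exact ⟨_, _, h2, (edgeAt_mem_hexEdges v c _).2 (Or.inr rfl)⟩

theorem boundary_symmDiff (R S : Finset Hexagon) :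
    boundary (symmDiff R S) = symmDiff (boundary R) (boundary S) := by
  ext e
  rw [edge_eq_edgeAt e]
  simp only [mem_boundary, Finset.mem_symmDiff]
  tauto

theorem boundary_singleton (h : Hexagon) : boundary {h} = hexEdges h := by
  ext e
  rw [edge_eq_edgeAt e, mem_boundary, edgeAt_mem_hexEdges]
  have hne : sector (e.1, false) e.2 ≠ sector (e.1, false) (e.2 + 2) := fun h => by
    have := sector_injective _ h
    revert this; generalize e.2 = c; revert c; decide
  simp only [Finset.mem_singleton]
  grind

theorem boundary_empty : boundary ∅ = ∅ := by simp [boundary]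

/-! ### Oriented boundaries as permutations of the vertices -/

/-- The vertex that follows `v` on the boundary of the region `r`, with `r` on the left; it is
`v` itself when `v` is not on the boundary. -/
def nextVertex (r : Hexagon → Bool) (v : Vertex) : Vertex :=
  if r (sector v 0) ∧ !r (sector v 2) then neighbor v 0
  else if r (sector v 1) ∧ !r (sector v 0) then neighbor v 1
  else if r (sector v 2) ∧ !r (sector v 1) then neighbor v 2
  else v

theorem nextVertex_of_out (r : Hexagon → Bool) (v : Vertex) (c : Fin 3)
    (h1 : r (sector v c) = true) (h2 : r (sector v (c + 2)) = false) :
    nextVertex r v = neighbor v c := by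
  revert h1 h2
  fin_cases c <;> simp +contextual [nextVertex]

theorem nextVertex_of_eq (r : Hexagon → Bool) (v : Vertex) (c : Fin 3)
    (h1 : r (sector v (c + 1)) = r (sector v c)) (h2 : r (sector v (c + 2)) = r (sector v c)) :
    nextVertex r v = v := by
  revert h1 h2
  fin_cases c <;> simp only [nextVertex] <;> intro h1 h2 <;> simp at h1 h2 <;> simp [h1, h2]

/-- Around a vertex of degree three a two-valued pattern is constant or changes exactly twice, once
in each direction. So a boundary has a well-defined way out of each vertex that it visits and never
crosses itself. -/
theorem out_or_eq (r : Hexagon → Bool) (v : Vertex) :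
    (∃ c, r (sector v c) = true ∧ r (sector v (c + 2)) = false) ∨
      ∀ c d, r (sector v c) = r (sector v d) := by
  have key : ∀ f : Fin 3 → Bool, (∃ c, f c = true ∧ f (c + 2) = false) ∨ ∀ c d, f c = f d := by
    decide
  exact key fun c => r (sector v c)

/-- The complement has the same boundary with the opposite orientation, so it supplies the inverse
of the walk. -/
theorem nextVertex_not_nextVertex (r : Hexagon → Bool) (v : Vertex) :
    nextVertex (fun h => !r h) (nextVertex r v) = v := by
  rcases out_or_eq r v with ⟨c, h1, h2⟩ | h
  · rw [nextVertex_of_out r v c h1 h2, nextVertex_of_out _ _ c, neighbor_neighbor]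
    · rw [sector_neighbor', h2]; rfl
    · rw [sector_neighbor, h1]; rfl
  · rw [nextVertex_of_eq r v 0 (h _ _) (h _ _), nextVertex_of_eq _ _ 0] <;> simp [h _ 0]

/-- `nextVertex` as a permutation. -/
def nextPerm (r : Hexagon → Bool) : Equiv.Perm Vertex where
  toFun := nextVertex r
  invFun := nextVertex fun h => !r h
  left_inv := nextVertex_not_nextVertex r
  right_inv v := by simpa using nextVertex_not_nextVertex (fun h => !r h) v

theorem neighbor_ne (v : Vertex) (c : Fin 3) : neighbor v c ≠ v := fun h => by
  have := congrArg Prod.snd h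
  rw [neighbor_snd] at this
  simp at this

theorem nextVertex_ne_iff (r : Hexagon → Bool) (v : Vertex) :
    nextVertex r v ≠ v ↔ ∃ c, r (sector v c) = true ∧ r (sector v (c + 2)) = false := by
  constructor
  · intro h
    refine (out_or_eq r v).resolve_right fun h' => h (nextVertex_of_eq r v 0 (h' _ _) (h' _ _))
  · rintro ⟨c, h1, h2⟩
    rw [nextVertex_of_out r v c h1 h2]
    exact neighbor_ne v c

/-! ### Rewiring of the oriented boundary at a hexagon -/

/-- The vertices of a hexagon in counterclockwise order. -/
def hexVertex (h : Hexagon) (k : Fin 6) : Vertex :=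
  ![(h, false), (h, true), (h + (0, 1), false), (h + (-1, 1), true), (h + (-1, 1), false),
    (h + (-1, 0), true)] k

/-- The direction class of the edge from `hexVertex h k` to `hexVertex h (k + 1)`. -/
def hexDir (k : Fin 6) : Fin 3 := ![0, 2, 1, 0, 2, 1] k

theorem sector_hexVertex (h : Hexagon) (k : Fin 6) : sector (hexVertex h k) (hexDir k) = h := by
  obtain ⟨m, n⟩ := h
  fin_cases k <;> simp [hexVertex, hexDir, sector]

theorem neighbor_hexVertex (h : Hexagon) (k : Fin 6) :
    neighbor (hexVertex h k) (hexDir k) = hexVertex h (k + 1) := by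
  obtain ⟨m, n⟩ := h
  fin_cases k <;> simp [hexVertex, hexDir, neighbor, shift]

theorem hexDir_succ (k : Fin 6) : hexDir (k + 1) = hexDir k + 2 := by revert k; decide

theorem hexVertex_injective (h : Hexagon) : Function.Injective (hexVertex h) := by
  obtain ⟨m, n⟩ := h
  intro k l
  fin_cases k <;> fin_cases l <;> simp [hexVertex]

theorem exists_hexVertex (v : Vertex) (c : Fin 3) :
    ∃ k, hexVertex (sector v c) k = v ∧ hexDir k = c := by
  obtain ⟨⟨m, n⟩, b⟩ := v
  cases b <;> fin_cases c
  · exact ⟨0, by simp [hexVertex, sector, hexDir]⟩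
  · exact ⟨2, by simp [hexVertex, sector, hexDir]⟩
  · exact ⟨4, by simp [hexVertex, sector, hexDir]⟩
  · exact ⟨3, by simp [hexVertex, sector, hexDir]⟩
  · exact ⟨5, by simp [hexVertex, sector, hexDir]⟩
  · exact ⟨1, by simp [hexVertex, sector, hexDir]⟩

/-- The permutation of the vertices of a hexagon `h` by which the oriented boundary changes when
`h` is added to a region; `b k` tells whether the neighbour of `h` across the edge from vertex
`k` to vertex `k + 1` belongs to the region. -/
def rewire (b : Fin 6 → Bool) (k : Fin 6) : Fin 6 :=
  if b k then (if b (k - 1) then k + 1 else k) else (if b (k + 1) then k + 2 else k + 1)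

def rewireInv (b : Fin 6 → Bool) (k : Fin 6) : Fin 6 :=
  if b (k - 1) then (if b (k - 2) then k - 1 else k - 2) else (if b k then k else k - 1)

theorem rewireInv_rewire (b : Fin 6 → Bool) (k : Fin 6) : rewireInv b (rewire b k) = k := by
  have key : ∀ b0 b1 b2 b3 b4 b5 : Bool, ∀ k,
      rewireInv ![b0, b1, b2, b3, b4, b5] (rewire ![b0, b1, b2, b3, b4, b5] k) = k := by decide
  have hb : b = ![b 0, b 1, b 2, b 3, b 4, b 5] := by
    ext i; fin_cases i <;> rfl
  rw [hb]
  exact key _ _ _ _ _ _ k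

theorem rewire_rewireInv (b : Fin 6 → Bool) (k : Fin 6) : rewire b (rewireInv b k) = k := by
  have key : ∀ b0 b1 b2 b3 b4 b5 : Bool, ∀ k,
      rewire ![b0, b1, b2, b3, b4, b5] (rewireInv ![b0, b1, b2, b3, b4, b5] k) = k := by decide
  have hb : b = ![b 0, b 1, b 2, b 3, b 4, b 5] := by
    ext i; fin_cases i <;> rfl
  rw [hb]
  exact key _ _ _ _ _ _ k

def rewirePerm (b : Fin 6 → Bool) : Equiv.Perm (Fin 6) :=
  ⟨rewire b, rewireInv b, rewireInv_rewire b, rewire_rewireInv b⟩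

/-- The number of changes of a cyclic pattern. -/
def numChanges (b : Fin 6 → Bool) : ℕ := (Finset.univ.filter fun k => b k ≠ b (k + 1)).card

-- A check of the 64 patterns of neighbours. The number of changes of a cyclic pattern is even; half
-- of it fixes the sign.
set_option maxRecDepth 100000 in
theorem sign_rewirePerm (b : Fin 6 → Bool) : ∃ m, numChanges b = 2 * m ∧
    ((Equiv.Perm.sign (rewirePerm b) : ℤˣ) : ℤ) = - (-1) ^ m := by
  have key : ∀ b0 b1 b2 b3 b4 b5 : Bool, ∃ m ∈ Finset.range 4,
      numChanges ![b0, b1, b2, b3, b4, b5] = 2 * m ∧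
        Equiv.Perm.sign (rewirePerm ![b0, b1, b2, b3, b4, b5]) = - (-1) ^ m := by
    decide +kernel
  have hb : b = ![b 0, b 1, b 2, b 3, b 4, b 5] := by
    ext i; fin_cases i <;> rfl
  rw [hb]
  obtain ⟨m, -, h1, h2⟩ := key (b 0) (b 1) (b 2) (b 3) (b 4) (b 5)
  exact ⟨m, h1, by rw [h2]; simp⟩

theorem out_unique (f : Fin 3 → Bool) {c d : Fin 3} (h1 : f c = true) (h2 : f (c + 2) = false)
    (h3 : f d = true) (h4 : f (d + 2) = false) : c = d := by
  revert f c d; decide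

/-! ### Loop parity as the sign of a permutation -/

/-- A permutation supported in a finite set, restricted to this set. -/
def restrictPerm (σ : Equiv.Perm Vertex) (B : Finset Vertex) (hB : ∀ v, v ∉ B → σ v = v) :
    Equiv.Perm {v // v ∈ B} :=
  σ.subtypePerm fun v => by
    constructor
    · intro h
      by_contra hv
      rw [hB v hv] at h
      exact hv h
    · intro h
      by_contra hv
      have h1 := σ.injective (hB _ hv)
      rw [h1] at hv
      exact hv h

theorem edgeAt_neighbor (v : Vertex) (c : Fin 3) : edgeAt (neighbor v c) c = edgeAt v c :=
  (edgeAt_eq_edgeAt_iff _ _ _ _).2 ⟨rfl, Or.inr rfl⟩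

/-- The indicator function of a region. -/
def region (R : Finset Hexagon) (h : Hexagon) : Bool := decide (h ∈ R)

theorem mem_boundary_region (R : Finset Hexagon) (v : Vertex) (c : Fin 3) :
    edgeAt v c ∈ boundary R ↔ region R (sector v c) ≠ region R (sector v (c + 2)) := by
  rw [mem_boundary]
  simp [region]

theorem exists_out (R : Finset Hexagon) (e : {e // e ∈ boundary R}) : ∃ x : Vertex × Fin 3,
    e.1 = edgeAt x.1 x.2 ∧ region R (sector x.1 x.2) = true ∧
      region R (sector x.1 (x.2 + 2)) = false := by
  obtain ⟨e, he⟩ := e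
  rw [edge_eq_edgeAt e, mem_boundary_region] at he
  cases h : region R (sector (e.1, false) e.2)
  · rw [h] at he
    refine ⟨(neighbor (e.1, false) e.2, e.2), ?_, ?_, ?_⟩
    · rw [edgeAt_neighbor]; rfl
    · rw [sector_neighbor']; simpa using he.symm
    · rw [sector_neighbor, h]
  · rw [h] at he
    exact ⟨((e.1, false), e.2), rfl, h, by simpa using he.symm⟩

theorem out_eq_out (r : Hexagon → Bool) {v w : Vertex} {c d : Fin 3}
    (h : edgeAt v c = edgeAt w d) (h1 : r (sector v c) = true)
    (h4 : r (sector w (d + 2)) = false) : v = w := by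
  obtain ⟨rfl, h | h⟩ := (edgeAt_eq_edgeAt_iff _ _ _ _).1 h
  · exact h
  · rw [h, sector_neighbor', h4] at h1
    cases h1

/-- The parity of the number of loops of `∂R` is the sign of the permutation that moves along
`∂R`. -/
theorem sign_nextPerm (R : Finset Hexagon) (B : Finset Vertex)
    (hB : ∀ v, v ∉ B → nextPerm (region R) v = v) :
    ((Equiv.Perm.sign (restrictPerm (nextPerm (region R)) B hB) : ℤˣ) : ℤ) =
      (-1) ^ numComponents (boundary R) := by
  set r := region R
  set σ := restrictPerm (nextPerm r) B hB
  have hσ : ∀ v : {v // v ∈ B}, ((σ v : {v // v ∈ B}) : Vertex) = nextVertex r v.1 :=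
    fun v => rfl
  have hσne : ∀ v : {v // v ∈ B}, σ v ≠ v ↔
      ∃ c, r (sector v.1 c) = true ∧ r (sector v.1 (c + 2)) = false := fun v => by
    rw [← nextVertex_ne_iff, ← hσ, Ne, Subtype.ext_iff]
  -- Each boundary edge is oriented with `R` on its left: `(x e).1` is its tail and `(x e).2` its
  -- class. The map `t` sends an edge to its tail, so that `σ` moves from a tail to the next one.
  choose x hx1 hx2 hx3 using exists_out R
  have hxB : ∀ e, (x e).1 ∈ B := fun e => by
    by_contra h
    exact (nextVertex_ne_iff r _).2 ⟨_, hx2 e, hx3 e⟩ (hB _ h)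
  let t : {e // e ∈ boundary R} → {v // v ∈ B} := fun e => ⟨(x e).1, hxB e⟩
  have hnext : ∀ e, nextVertex r (x e).1 = neighbor (x e).1 (x e).2 := fun e =>
    nextVertex_of_out r _ _ (hx2 e) (hx3 e)
  have hclass : ∀ e c, r (sector (x e).1 c) = true → r (sector (x e).1 (c + 2)) = false →
      c = (x e).2 := fun e c h1 h2 =>
    out_unique (fun c => r (sector (x e).1 c)) h1 h2 (hx2 e) (hx3 e)
  have ht : Function.Injective t := by
    intro e f h
    have h1 : (x e).1 = (x f).1 := congrArg Subtype.val h
    have h2 : (x e).2 = (x f).2 := hclass f _ (h1 ▸ hx2 e) (h1 ▸ hx3 e)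
    exact Subtype.ext (by rw [hx1, hx1, h1, h2])
  have hsupp : ∀ a, σ a ≠ a ↔ a ∈ Set.range t := by
    intro a
    rw [hσne]
    constructor
    · rintro ⟨c, h1, h2⟩
      have he : edgeAt a.1 c ∈ boundary R := by
        rw [mem_boundary_region]
        change r _ ≠ r _
        rw [h1, h2]; simp
      refine ⟨⟨_, he⟩, Subtype.ext ?_⟩
      exact (out_eq_out r (hx1 ⟨_, he⟩) h1 (hx3 ⟨_, he⟩)).symm
    · rintro ⟨e, rfl⟩
      exact ⟨_, hx2 e, hx3 e⟩
  have hin : ∀ (w : Vertex) (c : Fin 3) (e : {e // e ∈ boundary R}), edgeAt w c = e.1 →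
      w = (x e).1 ∨ (w = neighbor (x e).1 (x e).2 ∧ c = (x e).2) := by
    intro w c e h
    rw [hx1] at h
    obtain ⟨h1, h2 | h2⟩ := (edgeAt_eq_edgeAt_iff _ _ _ _).1 h
    · exact Or.inl h2
    · exact Or.inr ⟨h2, h1⟩
  have hmk : ∀ e f, (x f).1 = neighbor (x e).1 (x e).2 →
      (stringGraph (boundary R)).Adj e f := by
    intro e f h
    refine ⟨?_, (x f).1, (x e).2, (x f).2, ?_, (hx1 f).symm⟩
    · rintro rfl
      exact neighbor_ne _ _ h.symm
    · rw [h, edgeAt_neighbor, ← hx1]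
  have hadj : ∀ e f, (stringGraph (boundary R)).Adj e f ↔ t f = σ (t e) ∨ t e = σ (t f) := by
    intro e f
    have hval : ∀ e f, t f = σ (t e) ↔ (x f).1 = neighbor (x e).1 (x e).2 := fun e f => by
      rw [Subtype.ext_iff, hσ, ← hnext]
    rw [hval, hval]
    constructor
    · rintro ⟨hne, w, c, d, hc, hd⟩
      rcases hin w c e hc with h1 | ⟨h1, h1'⟩ <;> rcases hin w d f hd with h2 | ⟨h2, h2'⟩
      · exact absurd (ht (Subtype.ext (h1.symm.trans h2))) hne
      · exact Or.inr (h1.symm.trans h2)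
      · exact Or.inl (h2.symm.trans h1)
      -- Both edges end at `w`, but the boundary enters a vertex by one edge only, so they would
      -- coincide. Two edges that share an endpoint are thus consecutive.
      · exfalso
        have h3 : r (sector w (c + 2)) = true ∧ r (sector w c) = false := by
          rw [h1, h1', sector_neighbor, sector_neighbor']
          exact ⟨hx2 e, hx3 e⟩
        have h4 : r (sector w (d + 2)) = true ∧ r (sector w d) = false := by
          rw [h2, h2', sector_neighbor, sector_neighbor']
          exact ⟨hx2 f, hx3 f⟩
        have h5 : c = d := by
          have key : ∀ (f : Fin 3 → Bool) (c d : Fin 3), f (c + 2) = true → f c = false →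
              f (d + 2) = true → f d = false → c = d := by decide
          exact key (fun c => r (sector w c)) c d h3.1 h3.2 h4.1 h4.2
        exact hne (Subtype.ext (by rw [← hc, ← hd, h5]))
    · rintro (h | h)
      · exact hmk e f h
      · exact (hmk f e h).symm
  rw [sign_eq_neg_one_pow_card_cycleFactors σ (fun v => v.1.2), numComponents,
    card_connectedComponent_eq_card_cycleFactors _ σ t ht hsupp hadj]
  intro a ha
  obtain ⟨c, h1, h2⟩ := (hσne a).1 ha
  rw [hσ, nextVertex_of_out r _ c h1 h2, neighbor_snd]

/-- The neighbour of `h` across the edge from `hexVertex h k` to `hexVertex h (k + 1)`. -/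
def hexNeighbor (h : Hexagon) (k : Fin 6) : Hexagon := sector (hexVertex h k) (hexDir k + 2)

theorem hexNeighbor_pred (h : Hexagon) (k : Fin 6) :
    sector (hexVertex h (k + 1)) (hexDir (k + 1) + 1) = hexNeighbor h k := by
  have h1 : hexDir (k + 1) + 1 = hexDir k := by
    rw [hexDir_succ]; generalize hexDir k = c; revert c; decide
  rw [h1, ← neighbor_hexVertex, sector_neighbor', hexNeighbor]

/-- Where the neighbour across an edge of `h` is outside, the new boundary runs along this edge.
Where it is inside, the old boundary ran along the edge backwards, with `h` on its right, and the
new one does not use it. The cases compare where these two walks arrive; away from `h` they agree.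
-/
theorem nextVertex_rewire (r r' : Hexagon → Bool) (h : Hexagon) (hr : r h = false)
    (hr' : r' h = true) (heq : ∀ k, k ≠ h → r' k = r k) (k : Fin 6) :
    nextVertex r' (hexVertex h k) =
      nextVertex r (hexVertex h (rewire (fun k => r (hexNeighbor h k)) k)) := by
  have hsec := sector_hexVertex h
  have hne : ∀ v c d, sector v c = h → d ≠ c → r' (sector v d) = r (sector v d) :=
    fun v c d h1 h2 => heq _ fun h3 => h2 (sector_injective v (h3.trans h1.symm))
  have f1 : ∀ c : Fin 3, c + 1 ≠ c := by decide
  have f2 : ∀ c : Fin 3, c + 2 ≠ c := by decide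
  have f3 : ∀ c : Fin 3, c + 1 + 2 = c := by decide
  have f4 : ∀ c : Fin 3, c + 2 + 2 = c + 1 := by decide
  have f5 : ∀ c : Fin 3, c + 2 + 1 = c := by decide
  have r1 : ∀ k, r (sector (hexVertex h k) (hexDir k + 2)) = r (hexNeighbor h k) := fun k => rfl
  have r2 : ∀ k, r (sector (hexVertex h (k + 1)) (hexDir (k + 1) + 1)) = r (hexNeighbor h k) :=
    fun k => by rw [hexNeighbor_pred]
  have r3 : ∀ k, r (sector (hexVertex h k) (hexDir k + 1)) = r (hexNeighbor h (k - 1)) :=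
    fun k => by rw [← hexNeighbor_pred, sub_add_cancel]
  have n1 := neighbor_hexVertex h
  have n2 : ∀ k, neighbor (hexVertex h (k + 1)) (hexDir (k + 1) + 1) = hexVertex h k := fun k => by
    rw [hexDir_succ, f5, ← n1, neighbor_neighbor]
  have s1 : r' (sector (hexVertex h k) (hexDir k)) = true := by rw [hsec, hr']
  have s2 : r' (sector (hexVertex h k) (hexDir k + 1)) = r (hexNeighbor h (k - 1)) := by
    rw [hne _ _ _ (hsec k) (f1 _), r3]
  have s3 : r' (sector (hexVertex h k) (hexDir k + 2)) = r (hexNeighbor h k) := by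
    rw [hne _ _ _ (hsec k) (f2 _), r1]
  have s4 : ∀ k, r (sector (hexVertex h k) (hexDir k)) = false := fun k => by rw [hsec, hr]
  unfold rewire
  cases b0 : r (hexNeighbor h k) <;> simp only [b0, Bool.false_eq_true, if_false, if_true]
  · rw [nextVertex_of_out r' _ _ s1 (s3.trans b0), n1]
    rcases (Bool.eq_false_or_eq_true (r (hexNeighbor h (k + 1)))).symm with b1 | b1
    · simp only [b1, Bool.false_eq_true, if_false]
      rw [nextVertex_of_eq r _ (hexDir (k + 1))]
      · rw [r2, b0, s4]
      · rw [r1, b1, s4]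
    · simp only [b1, if_true]
      have h2 : k + 2 = k + 1 + 1 := by rw [add_assoc]; rfl
      rw [h2, nextVertex_of_out r _ (hexDir (k + 1 + 1) + 1), n2]
      · rw [r2, b1]
      · rw [f3, s4]
  · rcases (Bool.eq_false_or_eq_true (r (hexNeighbor h (k - 1)))).symm with b1 | b1
    · simp only [b1, Bool.false_eq_true, if_false]
      rw [nextVertex_of_out r' _ (hexDir k + 2) (s3.trans b0) (by rw [f4, s2, b1]),
        nextVertex_of_out r _ (hexDir k + 2) (by rw [r1, b0]) (by rw [f4, r3, b1])]
    · simp only [b1, if_true]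
      rw [nextVertex_of_eq r' _ (hexDir k) (by rw [s1, s2, b1]) (by rw [s1, s3, b0]),
        nextVertex_of_out r _ (hexDir (k + 1) + 1) (by rw [r2, b0]) (by rw [f3, s4]), n2]

/-! ### The local rule for the loop sign -/

/-- The edge at `hexVertex h k` outside the hexagon `h`. -/
def hexLeg (h : Hexagon) (k : Fin 6) : Edge := edgeAt (hexVertex h k) (hexDir k + 2)

/-- `- ∏ u ^ (occupation)` over the legs of a hexagon. -/
noncomputable def hexPhase (u : ℂ) (h : Hexagon) (C : Finset Edge) : ℂ :=
  - ∏ k : Fin 6, if hexLeg h k ∈ C then u else 1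

/-- `(-1) ^ (number of loops of ∂R)`. -/
noncomputable def loopSign (R : Finset Hexagon) : ℂ := (-1) ^ numComponents (boundary R)

theorem hexLeg_mem_boundary (R : Finset Hexagon) (h : Hexagon) (k : Fin 6) :
    hexLeg h k ∈ boundary R ↔
      region R (hexNeighbor h (k - 1)) ≠ region R (hexNeighbor h k) := by
  have f4 : ∀ c : Fin 3, c + 2 + 2 = c + 1 := by decide
  rw [hexLeg, mem_boundary_region, f4]
  have := hexNeighbor_pred h (k - 1)
  rw [sub_add_cancel] at this
  rw [this, ne_comm]
  rfl

/-- The leg at vertex `k` separates the neighbours `k - 1` and `k`, so the occupied legs are the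
changes of the pattern of neighbours. Their number is some `2 * m`, and `u ^ (2 * m) = (-1) ^ m` for
both choices of `u`. -/
theorem hexPhase_boundary {u : ℂ} (hu : u * u = -1) (h : Hexagon) (R : Finset Hexagon) :
    hexPhase u h (boundary R) = (((Equiv.Perm.sign (rewirePerm fun k =>
      region R (hexNeighbor h k)) : ℤˣ) : ℤ) : ℂ) := by
  obtain ⟨m, h1, h2⟩ := sign_rewirePerm fun k => region R (hexNeighbor h k)
  rw [h2, hexPhase]
  push_cast
  congr 1
  simp only [hexLeg_mem_boundary]
  rw [← Equiv.prod_comp (Equiv.addRight (1 : Fin 6))]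
  simp only [Equiv.coe_addRight, add_sub_cancel_right]
  rw [Finset.prod_ite, Finset.prod_const, Finset.prod_const_one, mul_one]
  change u ^ numChanges _ = _
  rw [h1, pow_mul, pow_two, hu]

theorem hexPhase_boundary_mul_self {u : ℂ} (hu : u * u = -1) (h : Hexagon) (R : Finset Hexagon) :
    hexPhase u h (boundary R) * hexPhase u h (boundary R) = 1 := by
  rw [hexPhase_boundary hu]
  norm_cast
  simp

/-- The vertices of the hexagons of `R`. -/
def regionVertices (R : Finset Hexagon) : Finset Vertex :=
  R.biUnion fun h => Finset.univ.image (hexVertex h)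

theorem mem_regionVertices (R : Finset Hexagon) (v : Vertex) (c : Fin 3) (h : sector v c ∈ R) :
    v ∈ regionVertices R := by
  obtain ⟨k, hk, -⟩ := exists_hexVertex v c
  exact Finset.mem_biUnion.2 ⟨_, h, Finset.mem_image.2 ⟨k, Finset.mem_univ _, hk⟩⟩

theorem nextPerm_eq_self_of_notMem (R S : Finset Hexagon) (hRS : R ⊆ S) (v : Vertex)
    (hv : v ∉ regionVertices S) : nextPerm (region R) v = v := by
  by_contra h
  obtain ⟨c, h1, -⟩ := (nextVertex_ne_iff _ _).1 h
  exact hv (mem_regionVertices S v c (hRS (by simpa [region] using h1)))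

/-- The walks along the two boundaries differ by `rewirePerm` on the vertices of `h`. Both are
restricted to the same finite set, the vertices of `insert h R`, so that their signs can be
compared. -/
theorem loopSign_insert {u : ℂ} (hu : u * u = -1) (R : Finset Hexagon) (h : Hexagon)
    (hR : h ∉ R) : loopSign (insert h R) = loopSign R * hexPhase u h (boundary R) := by
  set R' := insert h R
  have hB := nextPerm_eq_self_of_notMem R R' (Finset.subset_insert h R)
  have hB' := nextPerm_eq_self_of_notMem R' R' (Finset.Subset.refl _)
  set b : Fin 6 → Bool := fun k => region R (hexNeighbor h k)
  have hmem : ∀ k, hexVertex h k ∈ regionVertices R' := fun k =>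
    mem_regionVertices R' _ (hexDir k) (by rw [sector_hexVertex]; exact Finset.mem_insert_self _ _)
  let j : Fin 6 ↪ {v // v ∈ regionVertices R'} :=
    ⟨fun k => ⟨hexVertex h k, hmem k⟩, fun k l hkl =>
      hexVertex_injective h (congrArg Subtype.val hkl)⟩
  have hr : region R h = false := by simpa [region] using hR
  have hr' : region R' h = true := by simp [region, R']
  have heq : ∀ k, k ≠ h → region R' k = region R k := fun k hk => by simp [region, R', hk]
  have hmul : restrictPerm (nextPerm (region R')) _ hB' =
      restrictPerm (nextPerm (region R)) _ hB * (rewirePerm b).viaFintypeEmbedding j := by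
    ext1 v
    rw [Equiv.Perm.mul_apply]
    by_cases hv : v ∈ Set.range j
    · obtain ⟨k, rfl⟩ := hv
      rw [Equiv.Perm.viaFintypeEmbedding_apply_image]
      exact Subtype.ext (nextVertex_rewire _ _ h hr hr' heq k)
    · rw [Equiv.Perm.viaFintypeEmbedding_apply_notMem_range _ _ hv]
      have hs : ∀ c, region R' (sector v.1 c) = region R (sector v.1 c) := fun c => by
        refine heq _ fun h1 => hv ?_
        obtain ⟨k, hk, -⟩ := exists_hexVertex v.1 c
        exact ⟨k, Subtype.ext (by rw [← hk, h1]; rfl)⟩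
      refine Subtype.ext ?_
      change nextVertex _ _ = nextVertex _ _
      simp only [nextVertex, hs]
  have h1 := sign_nextPerm R _ hB
  have h2 := sign_nextPerm R' _ hB'
  rw [hmul, map_mul, Units.val_mul, h1, Equiv.Perm.viaFintypeEmbedding_sign] at h2
  rw [loopSign, loopSign, hexPhase_boundary hu]
  exact_mod_cast h2.symm

theorem symmDiff_singleton_of_notMem {α : Type*} [DecidableEq α] {R : Finset α} {h : α}
    (hR : h ∉ R) : symmDiff R {h} = insert h R := by
  ext k; simp only [Finset.mem_symmDiff, Finset.mem_singleton, Finset.mem_insert]; grind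

/-- The parity of the number of loops changes by a local rule. -/
theorem loopSign_symmDiff {u : ℂ} (hu : u * u = -1) (R : Finset Hexagon) (h : Hexagon) :
    loopSign (symmDiff R {h}) = loopSign R * hexPhase u h (boundary R) := by
  by_cases hR : h ∈ R
  · set S := symmDiff R {h}
    have hS : h ∉ S := by simp [S, Finset.mem_symmDiff, hR]
    have hRS : R = symmDiff S {h} := by simp [S]
    -- The phase depends on the neighbours of `h` but not on `h` itself, and it is its own inverse;
    -- removing `h` therefore follows the same rule as adding it.
    have hb : hexPhase u h (boundary R) = hexPhase u h (boundary S) := by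
      have hne : ∀ k, hexNeighbor h k ≠ h := fun k hk => by
        have h1 := sector_injective _ (hk.trans (sector_hexVertex h k).symm)
        revert h1; generalize hexDir k = c; revert c; decide
      have hreg : ∀ k, region R (hexNeighbor h k) = region S (hexNeighbor h k) := fun k => by
        simp [region, S, Finset.mem_symmDiff, hne k]
      simp only [hexPhase, hexLeg_mem_boundary, hreg]
    have h2 := loopSign_insert hu S h hS
    rw [← symmDiff_singleton_of_notMem hS, ← hRS] at h2
    rw [h2, mul_assoc, hb, hexPhase_boundary_mul_self hu, mul_one]
  · rw [symmDiff_singleton_of_notMem hR, loopSign_insert hu R h hR]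

theorem loopSign_mul_self (R : Finset Hexagon) : loopSign R * loopSign R = 1 := by
  rw [loopSign, ← mul_pow]; simp

/-! ### Closed edge sets bound regions -/

theorem exists_antidifference {M : Type*} [AddCommGroup M] (f : ℤ → M) :
    ∃ F : ℤ → M, ∀ k, F (k + 1) = F k + f k := by
  refine ⟨fun k => ∑ i ∈ Finset.range k.toNat, f i -
    ∑ i ∈ Finset.range (-k).toNat, f (-(i : ℤ) - 1), fun k => ?_⟩
  rcases le_or_gt 0 k with h | h
  · obtain ⟨n, rfl⟩ := Int.eq_ofNat_of_zero_le h
    have h1 : ((n : ℤ) + 1).toNat = n + 1 := by omega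
    have h2 : (-((n : ℤ) + 1)).toNat = 0 := by omega
    simp only [h1, h2]
    simp [Finset.sum_range_succ]
  · obtain ⟨n, hn⟩ := Int.eq_ofNat_of_zero_le (show 0 ≤ -(k + 1) by omega)
    obtain rfl : k = -(n : ℤ) - 1 := by omega
    have h1 : (-(n : ℤ) - 1 + 1).toNat = 0 := by omega
    have h2 : (-(n : ℤ) - 1).toNat = 0 := by omega
    have h3 : (-(-(n : ℤ) - 1 + 1)).toNat = n := by omega
    have h4 : (-(-(n : ℤ) - 1)).toNat = n + 1 := by omega
    simp only [h1, h2, h3, h4, Finset.sum_range_succ]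
    abel

/-- An edge function without sources is the coboundary of a hexagon function. -/
theorem exists_potential (p : Edge → ZMod 2)
    (hp : ∀ v, p (edgeAt v 0) + p (edgeAt v 1) + p (edgeAt v 2) = 0) :
    ∃ q : Hexagon → ZMod 2, ∀ v c, p (edgeAt v c) = q (sector v c) + q (sector v (c + 2)) := by
  -- The potential is found by integration: `A` along the row of hexagons `(m, 0)`, crossing edges
  -- of class 2, and then `V m` along each column, crossing edges of class 1.
  obtain ⟨A, hA⟩ := exists_antidifference fun m => p ((m, 1), 2)
  have hV : ∀ m : ℤ, ∃ V : ℤ → ZMod 2, V 0 = 0 ∧ ∀ k, V (k + 1) = V k + p ((m, k + 1), 1) := by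
    intro m
    obtain ⟨V, hV⟩ := exists_antidifference fun k => p ((m, k + 1), 1)
    exact ⟨fun k => V k - V 0, sub_self _, fun k => by simp only [hV]; ring⟩
  choose V hV0 hV using hV
  have two : ∀ a : ZMod 2, a + a = 0 := CharTwo.add_self_eq_zero
  let q : Hexagon → ZMod 2 := fun x => A x.1 + V x.1 x.2
  have hf : ∀ m n : ℤ, p ((m, n), 0) + p ((m, n), 1) + p ((m, n), 2) = 0 := fun m n => by
    simpa [edgeAt] using hp ((m, n), false)
  have ht : ∀ m n : ℤ, p ((m, n), 0) + p ((m + 1, n), 1) + p ((m, n + 1), 2) = 0 := fun m n => by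
    simpa [edgeAt, shift] using hp ((m, n), true)
  have hvert : ∀ m n : ℤ, p ((m, n), 1) = q (m, n) + q (m, n - 1) := fun m n => by
    have h := hV m (n - 1)
    rw [sub_add_cancel] at h
    simp only [q, h]
    linear_combination (-1 : ZMod 2) * two (A m) - two (V m (n - 1))
  -- The absence of sources at the vertices `((m, n), false)` and `((m, n), true)` shows that the
  -- defect of the equation for edges of class 2 does not depend on `n`. It vanishes in the row `n =
  -- 0` by the choice of `A`.
  have hstep : ∀ m n : ℤ, q (m + 1, n) + q (m, n) + p ((m, n + 1), 2) =
      q (m + 1, n - 1) + q (m, n - 1) + p ((m, n), 2) := fun m n => by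
    linear_combination hvert (m + 1) n + hvert m n + hf m n + ht m n
      - two (p ((m, n), 0)) - two (p ((m, n), 1)) - two (p ((m + 1, n), 1))
      + two (q (m + 1, n)) + two (q (m, n)) - two (p ((m, n), 2))
  have hzero : ∀ m : ℤ, q (m + 1, 0) + q (m, 0) + p ((m, 1), 2) = 0 := fun m => by
    simp only [q, hV0, hA]
    linear_combination two (A m) + two (p ((m, 1), 2))
  have hall : ∀ m n : ℤ, q (m + 1, n) + q (m, n) + p ((m, n + 1), 2) = 0 := by
    intro m n
    induction n using Int.induction_on with
    | zero => simpa using hzero m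
    | succ n ih =>
      rw [hstep, add_sub_cancel_right]
      exact ih
    | pred n ih =>
      have h := hstep m (-(n : ℤ))
      rw [ih] at h
      rw [sub_add_cancel]
      exact h.symm
  have hhor : ∀ m n : ℤ, p ((m, n), 2) = q (m, n - 1) + q (m + 1, n - 1) := fun m n => by
    have h := hall m (n - 1)
    rw [sub_add_cancel] at h
    linear_combination h - two (q (m, n - 1)) - two (q (m + 1, n - 1))
  have hdiag : ∀ m n : ℤ, p ((m, n), 0) = q (m, n) + q (m + 1, n - 1) := fun m n => by
    linear_combination hf m n - hvert m n - hhor m n - two (q (m, n))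
      - two (q (m, n - 1)) - two (q (m + 1, n - 1))
  have hA : ∀ (x : Cell) c, p (x, c) = q (sector (x, false) c) + q (sector (x, false) (c + 2)) := by
    rintro ⟨m, n⟩ c
    fin_cases c
    · simpa [sector, sub_eq_add_neg] using hdiag m n
    · simpa [sector, sub_eq_add_neg, add_comm] using hvert m n
    · simpa [sector, sub_eq_add_neg, add_comm] using hhor m n
  refine ⟨q, fun v c => ?_⟩
  obtain ⟨x, b⟩ := v
  cases b
  · exact hA x c
  · have h := hA (x - shift c) c
    have h1 := sector_neighbor (x, true) c
    have h2 := sector_neighbor' (x, true) c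
    simp only [neighbor, if_true] at h1 h2
    rw [h1, h2] at h
    rw [add_comm]
    exact h

/-- A source-free edge set agrees with the boundary of a finite region on each finite set. -/
theorem exists_boundary_eqOn (T : Set Edge)
    (hT : ∀ v, T.indicator (1 : Edge → ZMod 2) (edgeAt v 0) + T.indicator 1 (edgeAt v 1) +
      T.indicator 1 (edgeAt v 2) = 0)
    (E : Finset Edge) : ∃ Q : Finset Hexagon, ∀ e ∈ E, e ∈ boundary Q ↔ e ∈ T := by
  obtain ⟨q, hq⟩ := exists_potential _ hT
  -- The set where `q = 1` may be infinite, for instance on one side of an infinite path. Only the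
  -- hexagons next to edges of `E` are kept, which does not change the boundary on `E`.
  refine ⟨(E.biUnion fun e => {sector (e.1, false) e.2, sector (e.1, false) (e.2 + 2)}).filter
    fun h => q h = 1, fun e he => ?_⟩
  have h1 : ∀ h, h = sector (e.1, false) e.2 ∨ h = sector (e.1, false) (e.2 + 2) →
      (h ∈ (E.biUnion fun e => {sector (e.1, false) e.2, sector (e.1, false) (e.2 + 2)}).filter
        (fun h => q h = 1) ↔ q h = 1) := fun h hh => by
    rw [Finset.mem_filter, and_iff_right_iff_imp]
    intro _
    exact Finset.mem_biUnion.2 ⟨e, he, by simpa using hh⟩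
  have h2 := hq (e.1, false) e.2
  rw [← edge_eq_edgeAt] at h2
  have h3 : e ∈ T ↔ q (sector (e.1, false) e.2) + q (sector (e.1, false) (e.2 + 2)) = 1 := by
    rw [← h2]
    by_cases h : e ∈ T <;> simp [h]
  rw [h3]
  conv_lhs => rw [edge_eq_edgeAt e]
  rw [mem_boundary, h1 _ (Or.inl rfl), h1 _ (Or.inr rfl)]
  generalize q (sector (e.1, false) e.2) = a
  generalize q (sector (e.1, false) (e.2 + 2)) = b
  revert a b
  decide

/-! ### Exchange of a path with a hexagon at one vertex -/

/-- The edge set `C` has an even number of edges at each vertex. -/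
def IsClosedSet (C : Finset Edge) : Prop :=
  ∀ v c, edgeAt v (c + 2) ∈ C ↔ ¬ (edgeAt v c ∈ C ↔ edgeAt v (c + 1) ∈ C)

theorem isClosedSet_boundary (R : Finset Hexagon) : IsClosedSet (boundary R) := by
  intro v c
  have f3 : c + 1 + 2 = c := (by decide : ∀ c : Fin 3, c + 1 + 2 = c) c
  have f4 : c + 2 + 2 = c + 1 := by revert c; decide
  rw [mem_boundary, mem_boundary, mem_boundary, f3, f4]
  tauto

theorem inv_eq_neg_of_mul_self {u : ℂ} (hu : u * u = -1) : u⁻¹ = -u :=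
  inv_eq_of_mul_eq_one_right (by linear_combination -hu)

/-- The exchange identity at a vertex with incoming edge of class `a` and outgoing edge of class
`b`, for the hexagon in the sector `s`; `o` tells which edges at the vertex are occupied. -/
theorem vertex_exchange {u : ℂ} (hu : u * u = -1) (a b s : Fin 3) (hab : b = a + 1 ∨ b = a - 1)
    (o : Fin 3 → Prop) [DecidablePred o] (ho : o (a + 2) ↔ ¬ (o a ↔ o (a + 1))) :
    ((if b = a - 1 ∧ ¬ (o (-(a + b)) ↔ (s = -(a + b) ∨ s = -(a + b) + 2)) then u else 1) *
      (if b = a + 1 ∧ ¬ (o a ↔ (s = a ∨ s = a + 2)) ∧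
        ¬ ¬ (o b ↔ (s = b ∨ s = b + 2)) then -1 else 1)) =
    ((if b = a - 1 ∧ o (-(a + b)) then u else 1) *
      (if b = a + 1 ∧ o a ∧ ¬ o b then -1 else 1)) *
      (if s + 2 = a ∨ s + 2 = b then (if o (s + 2) then u⁻¹ else u) else 1) *
      (((if s = b then u⁻¹ else 1) * (if s = b + 2 then (if o b then -1 else 1) else 1)) *
        ((if s = a + 2 then u⁻¹ else 1) * (if s = a then (if o a then -1 else 1) else 1))⁻¹) := by
  have hi := inv_eq_neg_of_mul_self hu
  have f1 : a + 2 + 2 = a + 1 := (by decide : ∀ a : Fin 3, a + 2 + 2 = a + 1) a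
  have f2 : a + 1 + 2 = a := (by decide : ∀ a : Fin 3, a + 1 + 2 = a) a
  have f3 : a + 2 ≠ a + 1 := (by decide : ∀ a : Fin 3, a + 2 ≠ a + 1) a
  have f4 : a + 1 ≠ a := (by decide : ∀ a : Fin 3, a + 1 ≠ a) a
  have f5 : a + 2 ≠ a := (by decide : ∀ a : Fin 3, a + 2 ≠ a) a
  have f6 : a - 1 = a + 2 := (by decide : ∀ a : Fin 3, a - 1 = a + 2) a
  have f7 : -(a + (a + 2)) = a + 1 := (by decide : ∀ a : Fin 3, -(a + (a + 2)) = a + 1) a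
  rw [f6] at hab ⊢
  -- The cases are the turn of the path, the sector of the hexagon and the occupations of two edges;
  -- `ho` determines the third occupation.
  rcases hab with rfl | rfl <;> rcases fin3_cases a s with hs | hs | hs <;> by_cases h1 : o a <;>
    by_cases h2 : o (a + 1) <;> simp only [h1, h2] at ho <;>
    simp [hs, h1, h2, ho, hi, hu, f1, f2, f3, f4, f5, f7, f3.symm, f4.symm, f5.symm]

namespace ClosedPath

variable {n : ℕ} (P : ClosedPath n)

theorem vertex_succ_ne (i : ZMod n) : P.vertex (i + 1) ≠ P.vertex i := by
  rw [P.step]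
  exact neighbor_ne _ _

theorem dir_ne_dir_pred (i : ZMod n) : P.dir i ≠ P.dir (i - 1) := by
  rcases P.isLeft_or_isRight i with h | h
  · rw [h]; generalize P.dir (i - 1) = c; revert c; decide
  · rw [h]; generalize P.dir (i - 1) = c; revert c; decide

/-- A second visit to a vertex would need four different edges there, and there are only three. -/
theorem vertex_injective : Function.Injective P.vertex := by
  intro i j h
  by_contra hij
  have key : ∀ a b a' b' : Fin 3, b ≠ a → b' ≠ a' → b ≠ b' → a ≠ a' → b ≠ a' → b' ≠ a → False := by
    decide
  have hb : P.dir i ≠ P.dir j := fun h' => hij (P.edge_injective' (by rw [edge, edge, h, h']))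
  have hij' : i - 1 ≠ j - 1 := fun h' => hij (sub_left_injective h')
  have ha : P.dir (i - 1) ≠ P.dir (j - 1) := fun h' =>
    hij' (P.edge_injective' (by rw [edge_pred, edge_pred, h, h']))
  have hba : P.dir i ≠ P.dir (j - 1) := fun h' => by
    have h1 : i = j - 1 := P.edge_injective' (by rw [edge_pred, edge, h, h'])
    apply P.vertex_succ_ne i
    rw [h, h1, sub_add_cancel]
  have hab : P.dir j ≠ P.dir (i - 1) := fun h' => by
    have h1 : j = i - 1 := P.edge_injective' (by rw [edge_pred, edge, h, h'])
    apply P.vertex_succ_ne j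
    rw [← h, h1, sub_add_cancel]
  exact key _ _ _ _ (P.dir_ne_dir_pred i) (P.dir_ne_dir_pred j) hb ha hba hab

theorem edgeAt_mem_range_iff (i : ZMod n) (c : Fin 3) :
    edgeAt (P.vertex i) c ∈ Set.range P.edge ↔ c = P.dir (i - 1) ∨ c = P.dir i := by
  constructor
  · rintro ⟨j, hj⟩
    obtain ⟨h1, h2 | h2⟩ := (edgeAt_eq_edgeAt_iff _ _ _ _).1 hj.symm
    · rw [P.vertex_injective h2, h1]; exact Or.inr rfl
    · rw [← P.step] at h2
      rw [P.vertex_injective h2, add_sub_cancel_right, h1]; exact Or.inl rfl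
  · rintro (rfl | rfl)
    · exact ⟨i - 1, P.edge_pred i⟩
    · exact ⟨i, rfl⟩

theorem mem_range_vertex {v : Vertex} {c : Fin 3} (h : edgeAt v c ∈ Set.range P.edge) :
    v ∈ Set.range P.vertex := by
  obtain ⟨j, hj⟩ := h
  obtain ⟨-, h2 | h2⟩ := (edgeAt_eq_edgeAt_iff _ _ _ _).1 hj.symm
  · exact ⟨j, h2.symm⟩
  · exact ⟨j + 1, by rw [P.step, h2]⟩

/-- The edges of a closed path have no sources. -/
theorem indicator_range_edge (v : Vertex) :
    (Set.range P.edge).indicator (1 : Edge → ZMod 2) (edgeAt v 0) +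
      (Set.range P.edge).indicator 1 (edgeAt v 1) +
      (Set.range P.edge).indicator 1 (edgeAt v 2) = 0 := by
  classical
  simp only [Set.indicator_apply, Pi.one_apply]
  by_cases hv : v ∈ Set.range P.vertex
  · obtain ⟨i, rfl⟩ := hv
    simp only [edgeAt_mem_range_iff]
    have h := P.dir_ne_dir_pred i
    generalize P.dir i = a at *
    generalize P.dir (i - 1) = b at *
    revert a b
    decide
  · have h : ∀ c, edgeAt v c ∉ Set.range P.edge := fun c hc => hv (P.mem_range_vertex hc)
    simp only [h, if_false, add_zero]

/-- The phase that the string operator picks up at the vertex with index `i`. -/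
noncomputable def vertexPhase (u : ℂ) (i : ZMod n) (C : Finset Edge) : ℂ :=
  (if P.IsRight i ∧ P.leg i ∈ C then u else 1) *
    (if P.IsLeft i ∧ P.edge (i - 1) ∈ C ∧ P.edge i ∉ C then -1 else 1)

theorem vertexPhase_ne_zero {u : ℂ} (hu : u ≠ 0) (i : ZMod n) (C : Finset Edge) :
    P.vertexPhase u i C ≠ 0 := by
  unfold vertexPhase
  split_ifs <;> simp [hu]

open Classical in
/-- The factor by which the phase of the legs of `h` at `v` changes under a flip of the path. -/
noncomputable def legFlipPhase (u : ℂ) (h : Hexagon) (C : Finset Edge) (v : Vertex) : ℂ :=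
  ∏ s : Fin 3, if sector v s = h ∧ edgeAt v (s + 2) ∈ Set.range P.edge then
    (if edgeAt v (s + 2) ∈ C then u⁻¹ else u) else 1

/-- The contribution of the edge with index `i` to the exchange phase of the path with a
hexagon. -/
noncomputable def edgeExchange (u : ℂ) (h : Hexagon) (C : Finset Edge) (i : ZMod n) : ℂ :=
  (if h = sector (P.vertex i) (P.dir i) then u⁻¹ else 1) *
    (if h = sector (P.vertex i) (P.dir i + 2) then (if P.edge i ∈ C then -1 else 1) else 1)

theorem edgeExchange_ne_zero {u : ℂ} (hu : u ≠ 0) (h : Hexagon) (C : Finset Edge) (i : ZMod n) :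
    P.edgeExchange u h C i ≠ 0 := by
  unfold edgeExchange
  split_ifs <;> simp [hu]

theorem legFlipPhase_eq_one (u : ℂ) (h : Hexagon) (C : Finset Edge) (v : Vertex)
    (hv : ∀ s, sector v s ≠ h) : P.legFlipPhase u h C v = 1 :=
  Finset.prod_eq_one fun s _ => if_neg fun hs => hv s hs.1

open Classical in
theorem legFlipPhase_sector (u : ℂ) (C : Finset Edge) (v : Vertex) (s : Fin 3) :
    P.legFlipPhase u (sector v s) C v = if edgeAt v (s + 2) ∈ Set.range P.edge then
      (if edgeAt v (s + 2) ∈ C then u⁻¹ else u) else 1 := by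
  rw [legFlipPhase, Finset.prod_eq_single s]
  · simp
  · intro t _ ht
    exact if_neg fun h => ht (sector_injective v h.1)
  · simp

theorem vertex_eq_neighbor (i : ZMod n) :
    P.vertex i = neighbor (P.vertex (i - 1)) (P.dir (i - 1)) := by
  rw [← P.step, sub_add_cancel]

/-- This transports `vertex_exchange` to the path. The last factor is a coboundary along the path:
an edge contributes `u⁻¹` if `h` is on its left, and the sign of its occupation if `h` is on its
right. Only the leg factor survives in the product over the path. -/
theorem vertexPhase_symmDiff {u : ℂ} (hu : u * u = -1) (h : Hexagon) (C : Finset Edge)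
    (hC : IsClosedSet C) (i : ZMod n) :
    P.vertexPhase u i (symmDiff C (hexEdges h)) = P.vertexPhase u i C *
      P.legFlipPhase u h C (P.vertex i) *
        (P.edgeExchange u h C i * (P.edgeExchange u h C (i - 1))⁻¹) := by
  set v := P.vertex i with hv
  set a := P.dir (i - 1) with ha
  set b := P.dir i with hb
  have hleg : P.leg i = edgeAt v (-(a + b)) := rfl
  have hin : P.edge (i - 1) = edgeAt v a := P.edge_pred i
  have hout : P.edge i = edgeAt v b := rfl
  -- The contribution of the incoming edge is defined at its tail and must be read at its head,
  -- where the two sides have exchanged their labels.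
  have hs1 : sector (P.vertex (i - 1)) a = sector v (a + 2) := by
    rw [hv, P.vertex_eq_neighbor i, sector_neighbor]
  have hs2 : sector (P.vertex (i - 1)) (a + 2) = sector v a := by
    rw [hv, P.vertex_eq_neighbor i, sector_neighbor']
  have hmem : ∀ c, edgeAt v c ∈ symmDiff C (hexEdges h) ↔
      ¬ (edgeAt v c ∈ C ↔ (h = sector v c ∨ h = sector v (c + 2))) := fun c => by
    rw [Finset.mem_symmDiff, edgeAt_mem_hexEdges]; tauto
  have hL : P.IsLeft i ↔ b = a + 1 := Iff.rfl
  have hR : P.IsRight i ↔ b = a - 1 := Iff.rfl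
  unfold vertexPhase edgeExchange
  simp only [← ha, ← hb, ← hv, hs1, hs2, hin, hout, hleg, hL, hR, hmem]
  by_cases hh : ∃ s, sector v s = h
  · obtain ⟨s, rfl⟩ := hh
    have hinj : ∀ c d, sector v c = sector v d ↔ c = d := fun c d => (sector_injective v).eq_iff
    have hrange := P.edgeAt_mem_range_iff i (s + 2)
    rw [← hv, ← ha, ← hb] at hrange
    rw [legFlipPhase_sector]
    simp only [hinj, hrange]
    exact vertex_exchange hu a b s (P.isLeft_or_isRight i) (fun c => edgeAt v c ∈ C) (hC v a)
  · push Not at hh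
    have hh' : ∀ c, ¬ h = sector v c := fun c hc => hh c hc.symm
    simp [P.legFlipPhase_eq_one u h C v hh, hh']

end ClosedPath

/-! ### Exchange phase of a whole path with a hexagon -/

namespace ClosedPath

variable {n : ℕ} (P : ClosedPath n)

/-- A factor differs from `1` only at vertices of the path that are also vertices of `h`, so the
product can be taken over either set. The vertices of the path are pairwise distinct, so none is
counted twice. -/
theorem finprod_legFlipPhase (u : ℂ) (h : Hexagon) (C : Finset Edge) :
    ∏ᶠ i, P.legFlipPhase u h C (P.vertex i) = ∏ k, P.legFlipPhase u h C (hexVertex h k) := by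
  have hne : ∀ v, P.legFlipPhase u h C v ≠ 1 →
      v ∈ Set.range P.vertex ∧ v ∈ Finset.univ.image (hexVertex h) := by
    intro v hv
    have h1 : ∃ s, sector v s = h := by
      by_contra hs
      push Not at hs
      exact hv (P.legFlipPhase_eq_one u h C v hs)
    obtain ⟨s, rfl⟩ := h1
    refine ⟨?_, ?_⟩
    · rw [legFlipPhase_sector] at hv
      by_contra h2
      exact hv (if_neg fun h3 => h2 (P.mem_range_vertex h3))
    · obtain ⟨k, hk, -⟩ := exists_hexVertex v s
      exact Finset.mem_image.2 ⟨k, Finset.mem_univ _, hk⟩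
  rw [← finprod_mem_range P.vertex_injective (f := P.legFlipPhase u h C)]
  have h1 : ∀ v, (∏ᶠ _ : v ∈ Set.range P.vertex, P.legFlipPhase u h C v) =
      P.legFlipPhase u h C v := by
    intro v
    by_cases hv : v ∈ Set.range P.vertex
    · simp only [hv, finprod_true]
    · simp only [hv, finprod_false]
      by_contra h2
      exact hv (hne v (Ne.symm h2)).1
  rw [finprod_congr h1, finprod_eq_prod_of_mulSupport_subset (s := Finset.univ.image (hexVertex h)),
    Finset.prod_image fun _ _ _ _ h' => hexVertex_injective h h']
  intro v hv
  exact (hne v hv).2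

theorem finite_mulSupport_legFlipPhase (u : ℂ) (h : Hexagon) (C : Finset Edge) :
    (Function.mulSupport fun i => P.legFlipPhase u h C (P.vertex i)).Finite := by
  refine ((Finset.univ.image (hexVertex h)).finite_toSet.preimage
    (f := P.vertex) P.vertex_injective.injOn).subset fun i hi => ?_
  by_contra hv
  refine hi (P.legFlipPhase_eq_one u h C _ fun s hs => hv ?_)
  obtain ⟨k, hk, -⟩ := exists_hexVertex (P.vertex i) s
  exact Finset.mem_coe.2 (Finset.mem_image.2 ⟨k, Finset.mem_univ _, by rw [← hs, hk]⟩)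

theorem finite_mulSupport_edgeExchange (u : ℂ) (h : Hexagon) (C : Finset Edge) :
    (Function.mulSupport (P.edgeExchange u h C)).Finite := by
  refine ((hexEdges h).finite_toSet.preimage
    (f := P.edge) P.edge_injective'.injOn).subset fun i hi => ?_
  by_contra hv
  have h1 : ¬ (h = sector (P.vertex i) (P.dir i) ∨ h = sector (P.vertex i) (P.dir i + 2)) := by
    rw [← edgeAt_mem_hexEdges]; exact hv
  push Not at h1
  exact hi (by simp [edgeExchange, h1])

/-- The product telescopes because the shift of indices is a bijection of `ZMod n`, including `ZMod
0 = ℤ`; this is where the absence of endpoints enters. Finiteness of the support is stated too,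
since `finprod` is multiplicative only under this condition. -/
theorem finprod_edgeExchange {u : ℂ} (hu : u ≠ 0) (h : Hexagon) (C : Finset Edge) :
    (Function.mulSupport fun i =>
      P.edgeExchange u h C i * (P.edgeExchange u h C (i - 1))⁻¹).Finite ∧
    ∏ᶠ i, P.edgeExchange u h C i * (P.edgeExchange u h C (i - 1))⁻¹ = 1 := by
  have h1 := P.finite_mulSupport_edgeExchange u h C
  have h2 : (Function.mulSupport fun i => (P.edgeExchange u h C i)⁻¹).Finite := by
    simpa using h1
  have h3 : (Function.mulSupport fun i => (P.edgeExchange u h C (i - 1))⁻¹).Finite :=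
    h2.preimage (f := fun i => i - 1) (sub_left_injective.injOn)
  refine ⟨(h1.union h3).subset (Function.mulSupport_mul _ _), ?_⟩
  have h4 := finprod_comp_equiv (Equiv.subRight (1 : ZMod n))
    (f := fun i => (P.edgeExchange u h C i)⁻¹)
  simp only [Equiv.subRight_apply] at h4
  rw [finprod_mul_distrib h1 h3, h4, ← finprod_mul_distrib h1 h2]
  exact finprod_eq_one_of_forall_eq_one fun i => mul_inv_cancel₀ (P.edgeExchange_ne_zero hu h C i)

/-- The exchange phase of the path with a hexagon is the change of the phase of the hexagon under
a flip of the path. -/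
theorem finprod_vertexPhase {u : ℂ} (hu : u * u = -1) (h : Hexagon) (C D : Finset Edge)
    (hC : IsClosedSet C)
    (hD : ∀ k, hexLeg h k ∈ D ↔ ¬ (hexLeg h k ∈ C ↔ hexLeg h k ∈ Set.range P.edge)) :
    (∏ᶠ i, P.vertexPhase u i (symmDiff C (hexEdges h)) / P.vertexPhase u i C) *
      hexPhase u h C = hexPhase u h D := by
  have hu0 : u ≠ 0 := by rintro rfl; simp at hu
  have h1 : ∀ i, P.vertexPhase u i (symmDiff C (hexEdges h)) / P.vertexPhase u i C =
      P.legFlipPhase u h C (P.vertex i) *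
        (P.edgeExchange u h C i * (P.edgeExchange u h C (i - 1))⁻¹) := fun i => by
    rw [P.vertexPhase_symmDiff hu h C hC, mul_assoc,
      mul_div_cancel_left₀ _ (P.vertexPhase_ne_zero hu0 i C)]
  obtain ⟨h2, h3⟩ := P.finprod_edgeExchange hu0 h C
  rw [finprod_congr h1, finprod_mul_distrib (P.finite_mulSupport_legFlipPhase u h C) h2, h3,
    mul_one, finprod_legFlipPhase, hexPhase, hexPhase, mul_neg, ← Finset.prod_mul_distrib]
  congr 1
  -- If the leg is on the path, its occupation is flipped and its phase changes from `u` to `1` or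
  -- from `1` to `u`; otherwise it is unchanged.
  refine Finset.prod_congr rfl fun k _ => ?_
  have h4 := P.legFlipPhase_sector u C (hexVertex h k) (hexDir k)
  rw [sector_hexVertex] at h4
  rw [h4]
  have h7 := hD k
  have h8 : edgeAt (hexVertex h k) (hexDir k + 2) = hexLeg h k := rfl
  by_cases h5 : hexLeg h k ∈ C <;> by_cases h6 : hexLeg h k ∈ Set.range P.edge
  · rw [if_pos (h8 ▸ h6), if_pos (h8 ▸ h5), if_pos h5, if_neg (by tauto), inv_mul_cancel₀ hu0]
  · rw [if_neg (h8 ▸ h6), if_pos h5, if_pos (by tauto), one_mul]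
  · rw [if_pos (h8 ▸ h6), if_neg (h8 ▸ h5), if_neg h5, if_pos (by tauto), mul_one]
  · rw [if_neg (h8 ▸ h6), if_neg h5, if_neg (by tauto), one_mul]

end ClosedPath

/-! ### Monomial operators -/

/-- The operator maps `|C⟩` to `g C • |C △ A⟩`. -/
def ActsAs (O : Op) (g : Finset Edge → ℂ) (A : Finset Edge) : Prop :=
  ∀ C, O (ket C) = g C • ket (symmDiff C A)

/-- The function depends only on the intersection of its argument with a finite set. -/
def FinitelyDetermined {α β : Type*} (f : Finset α → β) : Prop :=
  ∃ N : Finset α, ∀ R S, (∀ x ∈ N, x ∈ R ↔ x ∈ S) → f R = f S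

namespace FinitelyDetermined

variable {α β : Type*}

theorem const (b : β) : FinitelyDetermined fun _ : Finset α => b := ⟨∅, fun _ _ _ => rfl⟩

theorem map₂ [DecidableEq α] {β' γ : Type*} {f : Finset α → β} {g : Finset α → β'}
    (hf : FinitelyDetermined f) (hg : FinitelyDetermined g) (k : β → β' → γ) :
    FinitelyDetermined fun R => k (f R) (g R) := by
  obtain ⟨M, hM⟩ := hf
  obtain ⟨N, hN⟩ := hg
  refine ⟨M ∪ N, fun R S h => ?_⟩
  simp only [hM R S fun x hx => h x (Finset.mem_union_left _ hx),
    hN R S fun x hx => h x (Finset.mem_union_right _ hx)]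

theorem comp_symmDiff [DecidableEq α] {f : Finset α → β} (hf : FinitelyDetermined f)
    (A : Finset α) : FinitelyDetermined fun R => f (symmDiff R A) := by
  obtain ⟨N, hN⟩ := hf
  exact ⟨N, fun R S h => hN _ _ fun x hx => by simp [Finset.mem_symmDiff, h x hx]⟩

theorem mem [DecidableEq α] (x : α) (b c : β) :
    FinitelyDetermined fun R : Finset α => if x ∈ R then b else c :=
  ⟨{x}, fun R S h => by simp only [h x (Finset.mem_singleton_self x)]⟩

theorem prod {ι : Type*} [DecidableEq α] (s : Finset ι) {f : ι → Finset α → ℂ}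
    (hf : ∀ i, FinitelyDetermined (f i)) : FinitelyDetermined fun R => ∏ i ∈ s, f i R := by
  classical
  induction s using Finset.induction_on with
  | empty => simpa using const (1 : ℂ)
  | insert i s hi ih =>
    simp only [Finset.prod_insert hi]
    exact (hf i).map₂ ih (· * ·)

theorem comp_boundary {f : Finset Edge → β} (hf : FinitelyDetermined f) :
    FinitelyDetermined fun R => f (boundary R) := by
  obtain ⟨N, hN⟩ := hf
  refine ⟨N.biUnion fun e => {sector (e.1, false) e.2, sector (e.1, false) (e.2 + 2)},
    fun R S h => hN _ _ fun e he => ?_⟩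
  rw [edge_eq_edgeAt e, mem_boundary, mem_boundary, h, h]
  · exact Finset.mem_biUnion.2 ⟨e, he, by simp⟩
  · exact Finset.mem_biUnion.2 ⟨e, he, by simp⟩

end FinitelyDetermined

/-- `O |C⟩ = g C |C △ A⟩` with a function `g` of finitely many edges. -/
def IsMonomial (O : Op) : Prop := ∃ g A, FinitelyDetermined g ∧ ActsAs O g A

theorem ActsAs.one : ActsAs 1 (fun _ => 1) ∅ := fun C => by
  have h : symmDiff C ∅ = C := symmDiff_bot C
  simp [h]

theorem ActsAs.mul {O Q : Op} {f g : Finset Edge → ℂ} {A B : Finset Edge} (hO : ActsAs O f A)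
    (hQ : ActsAs Q g B) : ActsAs (O * Q) (fun C => g C * f (symmDiff C B)) (symmDiff A B) := by
  intro C
  rw [mul_apply_eq_comp, hQ, map_smul, hO, smul_smul, symmDiff_assoc, symmDiff_comm B A]

theorem ket_apply (S T : Finset Edge) : ket S T = if T = S then 1 else 0 := by
  rw [ket, lp.single_apply, Pi.single_apply]

theorem symmDiff_eq_iff {α : Type*} [DecidableEq α] (R S T : Finset α) :
    symmDiff R S = T ↔ R = symmDiff T S := by
  constructor
  · rintro rfl; simp
  · rintro rfl; simp

theorem actsAs_opX (x : Edge) : ActsAs (opX x) (fun _ => 1) {x} := by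
  intro C
  ext S
  rw [opX_apply, ket_apply, one_smul, ket_apply]
  simp only [symmDiff_eq_iff]

theorem actsAs_opZ (x : Edge) : ActsAs (opZ x) (fun C => if x ∈ C then -1 else 1) ∅ := by
  intro C
  have h : symmDiff C ∅ = C := symmDiff_bot C
  ext S
  rw [h, opZ_apply, lp.coeFn_smul, Pi.smul_apply, smul_eq_mul, ket_apply]
  by_cases hS : S = C
  · rw [hS]
  · simp [hS]

theorem IsMonomial.one : IsMonomial 1 := ⟨_, _, FinitelyDetermined.const 1, ActsAs.one⟩

theorem IsMonomial.mul {O Q : Op} (hO : IsMonomial O) (hQ : IsMonomial Q) :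
    IsMonomial (O * Q) := by
  obtain ⟨f, A, hf, hO⟩ := hO
  obtain ⟨g, B, hg, hQ⟩ := hQ
  exact ⟨_, _, hg.map₂ (hf.comp_symmDiff B) (· * ·), hO.mul hQ⟩

/-- The local algebra is spanned by monomial operators. -/
theorem local_induction {p : Obs → Prop} (mono : ∀ O : Obs, IsMonomial (O : Op) → p O)
    (add : ∀ O Q, p O → p Q → p (O + Q)) (smul : ∀ (c : ℂ) O, p O → p (c • O)) (O : Obs)
    (hO : IsLocal O) : p O := by
  -- The generators are self-adjoint, so the star algebra that they generate is the span of their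
  -- products.
  have hstar : star (Set.range opX ∪ Set.range opZ) = Set.range opX ∪ Set.range opZ := by
    have hsub : ∀ a ∈ Set.range opX ∪ Set.range opZ, star a = a := by
      rintro _ (⟨x, rfl⟩ | ⟨x, rfl⟩)
      · exact star_opX x
      · exact star_opZ x
    ext a
    rw [Set.mem_star]
    constructor
    · intro h
      have := hsub _ h
      rw [star_star] at this
      rwa [this]
    · intro h
      rwa [hsub _ h]
  have hmem : (O : Op) ∈ Submodule.span ℂ
      ((Submonoid.closure (Set.range opX ∪ Set.range opZ) : Submonoid Op) : Set Op) := by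
    rw [← Algebra.adjoin_eq_span, Subalgebra.mem_toSubmodule]
    have h1 : (O : Op) ∈ localAlgebra.toSubalgebra := hO
    rw [localAlgebra, StarAlgebra.adjoin_toSubalgebra, hstar, Set.union_self] at h1
    exact h1
  have hclos : ∀ a ∈ Submonoid.closure (Set.range opX ∪ Set.range opZ),
      IsMonomial a ∧ a ∈ localAlgebra := by
    intro a ha
    induction ha using Submonoid.closure_induction with
    | mem a ha =>
      refine ⟨?_, StarAlgebra.subset_adjoin ℂ _ ha⟩
      rcases ha with ⟨x, rfl⟩ | ⟨x, rfl⟩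
      · exact ⟨_, _, FinitelyDetermined.const 1, actsAs_opX x⟩
      · exact ⟨_, _, FinitelyDetermined.mem x _ _, actsAs_opZ x⟩
    | one => exact ⟨IsMonomial.one, one_mem _⟩
    | mul a b _ _ ha hb => exact ⟨ha.1.mul hb.1, mul_mem ha.2 hb.2⟩
  have hmain : ∀ a ∈ Submodule.span ℂ
      ((Submonoid.closure (Set.range opX ∪ Set.range opZ) : Submonoid Op) : Set Op),
      ∃ h : a ∈ quasiLocalAlgebra, p ⟨a, h⟩ := by
    intro a ha
    induction ha using Submodule.span_induction with
    | mem a ha =>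
      obtain ⟨h1, h2⟩ := hclos a ha
      exact ⟨StarSubalgebra.le_topologicalClosure _ h2, mono _ h1⟩
    | zero =>
      refine ⟨zero_mem _, ?_⟩
      have := smul 0 1 (mono 1 IsMonomial.one)
      rwa [zero_smul] at this
    | add a b _ _ ha hb =>
      obtain ⟨h1, h2⟩ := ha
      obtain ⟨h3, h4⟩ := hb
      exact ⟨add_mem h1 h3, add _ _ h2 h4⟩
    | smul c a _ ha =>
      obtain ⟨h1, h2⟩ := ha
      exact ⟨SMulMemClass.smul_mem c h1, smul c _ h2⟩
  exact (hmain _ hmem).2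

theorem inner_ket (S T : Finset Edge) : inner ℂ (ket S) (ket T) = if S = T then (1 : ℂ) else 0 := by
  rw [ket, lp.inner_single_left, ket_apply]
  simp

/-! ### The superposition of loops -/

/-- `D s` stands for the iterated symmetric difference of the sets `B i`. The homomorphism `φ` lets
the lemma serve products of observables as well as products in the unitary group. -/
theorem ActsAs.noncommProd_flip {M α : Type*} [Monoid M] [DecidableEq α] (φ : M →* Op)
    (f : α → M) (B : α → Finset Edge) (D : Finset α → Finset Edge)
    (hf : ∀ i, ActsAs (φ (f i)) (fun _ => 1) (B i)) (hD : D ∅ = ∅)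
    (hD' : ∀ i s, i ∉ s → D (insert i s) = symmDiff (D s) (B i)) (s : Finset α)
    (comm : (s : Set α).Pairwise (Function.onFun Commute f)) :
    ActsAs (φ (s.noncommProd f comm)) (fun _ => 1) (D s) := by
  induction s using Finset.induction_on with
  | empty =>
    rw [Finset.noncommProd_empty, map_one, hD]
    exact ActsAs.one
  | insert i s hi ih =>
    rw [Finset.noncommProd_insert_of_notMem _ _ _ _ hi, map_mul, hD' i s hi, symmDiff_comm]
    simpa using (hf i).mul (ih (comm.mono (by simp)))

theorem ActsAs.noncommProd_phase {M α : Type*} [Monoid M] [DecidableEq α] (φ : M →* Op)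
    (f : α → M) (ρ : α → Finset Edge → ℂ) (hf : ∀ i, ActsAs (φ (f i)) (ρ i) ∅) (s : Finset α)
    (comm : (s : Set α).Pairwise (Function.onFun Commute f)) :
    ActsAs (φ (s.noncommProd f comm)) (fun C => ∏ i ∈ s, ρ i C) ∅ := by
  induction s using Finset.induction_on with
  | empty =>
    rw [Finset.noncommProd_empty, map_one]
    simpa using ActsAs.one
  | insert i s hi ih =>
    rw [Finset.noncommProd_insert_of_notMem _ _ _ _ hi, map_mul]
    have h := (hf i).mul (ih (comm.mono (by simp)))
    have hbot : ∀ C : Finset Edge, symmDiff C ∅ = C := symmDiff_bot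
    simp only [hbot] at h
    simp only [Finset.prod_insert hi]
    simpa only [mul_comm] using h

/-- The inclusion of the quasi-local algebra into the bounded operators. -/
noncomputable def obsHom : Obs →* Op := (quasiLocalAlgebra.subtype : Obs →* Op)

theorem actsAs_hexOp (h : Hexagon) : ActsAs (hexOp h : Op) (fun _ => 1) (hexEdges h) :=
  ActsAs.noncommProd_flip obsHom sigmaX (fun x => {x}) id actsAs_opX rfl
    (fun _ _ hi => (symmDiff_singleton_of_notMem hi).symm) _ _

theorem actsAs_regionOp (R : Finset Hexagon) :
    ActsAs (regionOp R : Op) (fun _ => 1) (boundary R) :=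
  ActsAs.noncommProd_flip obsHom hexOp hexEdges boundary actsAs_hexOp boundary_empty
    (fun _ _ hi => by
      rw [← symmDiff_singleton_of_notMem hi, boundary_symmDiff, boundary_singleton]) _ _

/-- A nonempty finite region has a hexagon with maximal first coordinate, and the edge between it
and its neighbour shifted by `(1, -1)` is then on the boundary. Thus different regions give
orthogonal loop configurations. -/
theorem boundary_injective : Function.Injective boundary := by
  have key : ∀ R : Finset Hexagon, boundary R = ∅ → R = ∅ := by
    intro R hR
    by_contra hne
    obtain ⟨h, hh, hmax⟩ := R.exists_max_image (fun h => h.1) (Finset.nonempty_iff_ne_empty.2 hne)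
    have h1 : edgeAt (h, false) 0 ∉ boundary R := by rw [hR]; simp
    rw [mem_boundary, not_not] at h1
    have h2 : sector (h, false) 0 = h := by simp [sector]
    have h3 : sector (h, false) (0 + 2) = h + (1, -1) := by simp [sector]
    rw [h2, h3] at h1
    have h4 := hmax _ (h1.1 hh)
    simp at h4
  intro R S h
  have h1 := key (symmDiff R S) (by rw [boundary_symmDiff, h]; simp)
  exact symmDiff_eq_bot.1 h1

theorem semionVector_eq (Λ : Finset Hexagon) : semionVector Λ =
    ((Real.sqrt (1 / 2 ^ Λ.card) : ℝ) : ℂ) •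
      ∑ R ∈ Λ.powerset, loopSign R • ket (boundary R) := by
  rw [semionVector]
  congr 1
  refine Finset.sum_congr rfl fun R _ => ?_
  have h : symmDiff ∅ (boundary R) = boundary R := bot_symmDiff _
  rw [actsAs_regionOp, h, one_smul, loopSign]

/-- The average of a function over the subsets of a finite set. -/
noncomputable def average {α : Type*} (Λ : Finset α) (G : Finset α → ℂ) : ℂ :=
  1 / 2 ^ Λ.card * ∑ R ∈ Λ.powerset, G R

theorem star_loopSign (R : Finset Hexagon) : starRingEnd ℂ (loopSign R) = loopSign R := by
  simp [loopSign]

theorem finiteState_eq_sum {O : Obs} {g : Finset Edge → ℂ} {A : Finset Edge}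
    (hO : ActsAs (O : Op) g A) (Λ : Finset Hexagon) : finiteState Λ O =
      average Λ fun R => ∑ S ∈ Λ.powerset,
        if boundary S = symmDiff (boundary R) A then loopSign S * loopSign R * g (boundary R)
        else 0 := by
  have hc : ((Real.sqrt (1 / 2 ^ Λ.card) : ℝ) : ℂ) * ((Real.sqrt (1 / 2 ^ Λ.card) : ℝ) : ℂ) =
      1 / 2 ^ Λ.card := by
    rw [← Complex.ofReal_mul, Real.mul_self_sqrt (by positivity)]
    push_cast
    rfl
  rw [finiteState_apply, semionVector_eq, map_smul, inner_smul_left, inner_smul_right,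
    Complex.conj_ofReal, ← mul_assoc, hc, average, map_sum, inner_sum]
  congr 1
  refine Finset.sum_congr rfl fun R _ => ?_
  rw [sum_inner]
  refine Finset.sum_congr rfl fun S _ => ?_
  rw [map_smul, hO, inner_smul_left, inner_smul_right, inner_smul_right, inner_ket, star_loopSign]
  split_ifs <;> ring

/-- Only `S = R △ T` contributes to the double sum, and it is a subset of `Λ` because `T` is. -/
theorem finiteState_of_boundary {O : Obs} {g : Finset Edge → ℂ} {T : Finset Hexagon}
    (hO : ActsAs (O : Op) g (boundary T)) {Λ : Finset Hexagon} (hT : T ⊆ Λ) :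
    finiteState Λ O =
      average Λ fun R => loopSign (symmDiff R T) * loopSign R * g (boundary R) := by
  rw [finiteState_eq_sum hO, average, average]
  congr 1
  refine Finset.sum_congr rfl fun R hR => ?_
  simp only [← boundary_symmDiff, boundary_injective.eq_iff]
  rw [Finset.sum_ite_eq']
  rw [if_pos]
  rw [Finset.mem_powerset] at hR ⊢
  exact Finset.symmDiff_subset_union.trans (Finset.union_subset hR hT)

theorem finiteState_of_not_boundary {O : Obs} {g : Finset Edge → ℂ} {A : Finset Edge}
    (hO : ActsAs (O : Op) g A) (hA : ∀ T, A ≠ boundary T) (Λ : Finset Hexagon) :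
    finiteState Λ O = 0 := by
  rw [finiteState_eq_sum hO, average]
  refine mul_eq_zero_of_right _ (Finset.sum_eq_zero fun R _ => Finset.sum_eq_zero fun S _ => ?_)
  rw [if_neg]
  intro h
  apply hA (symmDiff S R)
  rw [boundary_symmDiff, h, symmDiff_comm (boundary R), symmDiff_symmDiff_cancel_right]

/-! ### The thermodynamic limit -/

/-- A further element that `G` does not see doubles both the sum and the number of subsets. -/
theorem average_eq_of_subset {α : Type*} [DecidableEq α] {N Λ : Finset α} (h : N ⊆ Λ)
    {G : Finset α → ℂ} (hG : ∀ R S, (∀ x ∈ N, x ∈ R ↔ x ∈ S) → G R = G S) :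
    average Λ G = average N G := by
  have key : ∀ M : Finset α, Disjoint M N → average (N ∪ M) G = average N G := by
    intro M
    induction M using Finset.induction_on with
    | empty => simp
    | insert a M ha ih =>
      intro hM
      rw [Finset.disjoint_insert_left] at hM
      have haM : a ∉ N ∪ M := by simp [ha, hM.1]
      rw [← ih hM.2, Finset.union_insert, average, average, Finset.card_insert_of_notMem haM,
        Finset.sum_powerset_insert haM]
      have h1 : ∀ R ∈ (N ∪ M).powerset, G (insert a R) = G R := fun R _ => hG _ _ fun x hx => by
        have : x ≠ a := fun h => hM.1 (h ▸ hx)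
        simp [this]
      rw [Finset.sum_congr rfl h1, pow_succ]
      field_simp
      ring
  have h2 := key (Λ \ N) Finset.sdiff_disjoint
  rwa [Finset.union_sdiff_of_subset h] at h2

theorem FinitelyDetermined.hexPhase (u : ℂ) (h : Hexagon) :
    FinitelyDetermined (hexPhase u h) := by
  have h1 := FinitelyDetermined.prod (Finset.univ : Finset (Fin 6))
    fun k => FinitelyDetermined.mem (hexLeg h k) u 1
  exact h1.map₂ (FinitelyDetermined.const 0) fun x _ => -x

/-- The relative sign of the loop superposition under a finite change of the region is local. -/
theorem finitelyDetermined_loopSign_mul (T : Finset Hexagon) :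
    FinitelyDetermined fun R => loopSign (symmDiff R T) * loopSign R := by
  induction T using Finset.induction_on with
  | empty =>
    have h : ∀ R : Finset Hexagon, symmDiff R ∅ = R := symmDiff_bot
    simp only [h, loopSign_mul_self]
    exact FinitelyDetermined.const 1
  | insert h T hT ih =>
    have h1 := ih.map₂
      (((FinitelyDetermined.hexPhase Complex.I h).comp_symmDiff (boundary T)).comp_boundary) (· * ·)
    convert h1 using 2 with R
    rw [← symmDiff_singleton_of_notMem hT, ← symmDiff_assoc,
      loopSign_symmDiff Complex.I_mul_I, boundary_symmDiff]
    ring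

/-- The states of a monomial operator are eventually constant. -/
theorem eventually_finiteState_eq_of_monomial (O : Obs) (hO : IsMonomial (O : Op)) :
    ∃ c, ∀ᶠ Λ in atTop, finiteState Λ O = c := by
  obtain ⟨g, A, hg, hO⟩ := hO
  by_cases hA : ∃ T, A = boundary T
  · obtain ⟨T, rfl⟩ := hA
    obtain ⟨N, hN⟩ := (finitelyDetermined_loopSign_mul T).map₂ hg.comp_boundary (· * ·)
    refine ⟨average N fun R => loopSign (symmDiff R T) * loopSign R * g (boundary R), ?_⟩
    filter_upwards [eventually_ge_atTop T, eventually_ge_atTop N] with Λ hT hΛ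
    rw [finiteState_of_boundary hO hT, average_eq_of_subset hΛ hN]
  · push Not at hA
    exact ⟨0, Eventually.of_forall fun Λ => finiteState_of_not_boundary hO hA Λ⟩

theorem eventually_finiteState_eq (O : Obs) (hO : IsLocal O) :
    ∃ c, ∀ᶠ Λ in atTop, finiteState Λ O = c := by
  refine local_induction (p := fun O => ∃ c, ∀ᶠ Λ in atTop, finiteState Λ O = c)
    eventually_finiteState_eq_of_monomial ?_ ?_ O hO
  · rintro O Q ⟨c, hc⟩ ⟨d, hd⟩
    exact ⟨c + d, by filter_upwards [hc, hd] with Λ h1 h2; rw [map_add, h1, h2]⟩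
  · rintro a O ⟨c, hc⟩
    exact ⟨a * c, by filter_upwards [hc] with Λ h1; rw [map_smul, h1, smul_eq_mul]⟩

/-- The squared norm is the state of the identity, the average of `loopSign R * loopSign R = 1`. -/
theorem norm_semionVector (Λ : Finset Hexagon) : ‖semionVector Λ‖ = 1 := by
  have h1 : finiteState Λ 1 = 1 := by
    have hO : ActsAs ((1 : Obs) : Op) (fun _ => 1) (boundary ∅) := by
      rw [boundary_empty]; exact ActsAs.one
    have h : ∀ R : Finset Hexagon, symmDiff R ∅ = R := symmDiff_bot
    rw [finiteState_of_boundary hO (Finset.empty_subset Λ)]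
    simp [h, loopSign_mul_self, average]
  rw [finiteState_apply] at h1
  change inner ℂ (semionVector Λ) (semionVector Λ) = (1 : ℂ) at h1
  rw [inner_self_eq_norm_sq_to_K] at h1
  have h2 : ‖semionVector Λ‖ ^ 2 = 1 := by
    apply Complex.ofReal_injective
    rw [Complex.ofReal_pow, Complex.ofReal_one]
    exact h1
  exact (pow_eq_one_iff_of_nonneg (norm_nonneg _) two_ne_zero).1 h2

theorem norm_finiteState_le (Λ : Finset Hexagon) (O : Obs) : ‖finiteState Λ O‖ ≤ ‖O‖ := by
  rw [finiteState_apply]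
  calc _ ≤ ‖semionVector Λ‖ * ‖(O : Op) (semionVector Λ)‖ := norm_inner_le_norm _ _
    _ ≤ 1 * (‖(O : Op)‖ * 1) := by
      rw [← norm_semionVector Λ]
      nth_rewrite 2 [norm_semionVector]
      rw [norm_semionVector, one_mul, one_mul]
      have := (O : Op).le_opNorm (semionVector Λ)
      rwa [norm_semionVector] at this
    _ = ‖O‖ := by rw [one_mul, mul_one]; rfl

/-- A local observable within `r / 3` of `O` has eventually constant states, and the states are
contractions, so the states of `O` form a Cauchy net. -/
theorem exists_tendsto_finiteState (O : Obs) :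
    ∃ c, Tendsto (fun Λ => finiteState Λ O) atTop (𝓝 c) := by
  classical
  refine cauchy_map_iff_exists_tendsto.mp (Metric.cauchy_iff.mpr ⟨inferInstance, ?_⟩)
  intro r hr
  obtain ⟨L, hL, hd⟩ := Metric.dense_iff.mp dense_local O (r / 3) (by positivity)
  rw [Metric.mem_ball, dist_eq_norm] at hL
  obtain ⟨c, e⟩ := eventually_finiteState_eq L hd
  refine ⟨_, Filter.image_mem_map e, ?_⟩
  have key : ∀ Λ, finiteState Λ L = c → ‖finiteState Λ O - c‖ < r / 3 := by
    intro Λ hΛ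
    rw [← hΛ, ← map_sub]
    refine (norm_finiteState_le _ _).trans_lt ?_
    rwa [norm_sub_rev]
  rintro _ ⟨Λ, hΛ, rfl⟩ _ ⟨Λ', hΛ', rfl⟩
  rw [dist_eq_norm]
  have h1 := key Λ hΛ
  have h2 := key Λ' hΛ'
  rw [norm_sub_rev] at h2
  calc _ = ‖(finiteState Λ O - c) + (c - finiteState Λ' O)‖ := by rw [sub_add_sub_cancel]
    _ ≤ _ := norm_add_le _ _
    _ < r := by linarith

/-- The finite states converge to the double semion state. -/
theorem tendsto_finiteState : Tendsto finiteState atTop (𝓝 doubleSemionState) := by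
  refine tendsto_nhds_limUnder ?_
  choose φ hφ using exists_tendsto_finiteState
  -- `doubleSemionState` is a `limUnder`, which is meaningful only once a limit exists. The
  -- pointwise limits are assembled into a bounded functional.
  let f : Obs →ₗ[ℂ] ℂ := linearMapOfTendsto φ (fun Λ => (finiteState Λ).toLinearMap)
    (tendsto_pi_nhds.2 hφ)
  have hf : ∀ O, ‖f O‖ ≤ 1 * ‖O‖ := fun O => by
    rw [one_mul]
    exact le_of_tendsto (hφ O).norm (Eventually.of_forall fun Λ => norm_finiteState_le Λ O)
  refine ⟨StrongDual.toWeakDual (f.mkContinuous 1 hf), ?_⟩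
  rw [tendsto_iff_forall_eval_tendsto_topDualPairing]
  exact hφ

theorem tendsto_finiteState_apply (O : Obs) :
    Tendsto (fun Λ => finiteState Λ O) atTop (𝓝 (doubleSemionState O)) :=
  tendsto_iff_forall_eval_tendsto_topDualPairing.1 tendsto_finiteState O

/-! ### Invariance under conjugations -/

/-- Conjugation of a monomial operator by a monomial unitary. -/
theorem ActsAs.conj {W : unitary Obs} {O : Obs} {φ g : Finset Edge → ℂ} {T A : Finset Edge}
    (hW : ActsAs ((W : Obs) : Op) φ T) (hφ : ∀ C, φ C ≠ 0) (hO : ActsAs (O : Op) g A) :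
    ActsAs ((Unitary.conjStarAlgAut ℂ Obs W O : Obs) : Op)
      (fun C => g (symmDiff C T) *
        (φ (symmDiff (symmDiff C T) A) / φ (symmDiff C T))) A := by
  -- `W` maps `|C △ T⟩` to a nonzero multiple of `|C⟩`, and unitarity turns this into the action of
  -- the adjoint.
  have hstar : ∀ C, star ((W : Obs) : Op) (ket C) =
      (φ (symmDiff C T))⁻¹ • ket (symmDiff C T) := by
    intro C
    have h1 : star ((W : Obs) : Op) * ((W : Obs) : Op) = 1 :=
      congrArg Subtype.val (Unitary.coe_star_mul_self W)
    have h2 := hW (symmDiff C T)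
    rw [symmDiff_symmDiff_cancel_right] at h2
    have h3 : star ((W : Obs) : Op) (((W : Obs) : Op) (ket (symmDiff C T))) =
        ket (symmDiff C T) := by
      rw [← mul_apply_eq_comp, h1]; rfl
    rw [h2, map_smul] at h3
    rw [← h3, smul_smul, inv_mul_cancel₀ (hφ _), one_smul]
  intro C
  rw [Unitary.conjStarAlgAut_apply]
  change ((W : Obs) : Op) ((O : Op) (star ((W : Obs) : Op) (ket C))) = _
  rw [hstar, map_smul, hO, map_smul, map_smul, hW, smul_smul, smul_smul,
    symmDiff_right_comm _ A, symmDiff_symmDiff_cancel_right]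
  congr 1
  simp only [div_eq_mul_inv]
  ring

theorem sum_powerset_symmDiff {α : Type*} [DecidableEq α] {Q Λ : Finset α} (h : Q ⊆ Λ)
    (G : Finset α → ℂ) : average Λ G = average Λ fun R => G (symmDiff R Q) := by
  rw [average, average]
  congr 1
  have hmem : ∀ R ∈ Λ.powerset, symmDiff R Q ∈ Λ.powerset := fun R hR => by
    rw [Finset.mem_powerset] at hR ⊢
    exact Finset.symmDiff_subset_union.trans (Finset.union_subset hR h)
  exact Finset.sum_bij' (fun R _ => symmDiff R Q) (fun R _ => symmDiff R Q) hmem hmem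
    (fun R _ => symmDiff_symmDiff_cancel_right _ _) (fun R _ => symmDiff_symmDiff_cancel_right _ _)
    (fun R _ => by rw [symmDiff_symmDiff_cancel_right])

/-- The change of sign of the loop superposition on adding `T`, compared before and after
adding `Q`. -/
noncomputable def exchangeSign (Q T R : Finset Hexagon) : ℂ :=
  (loopSign R * loopSign (symmDiff R T)) *
    (loopSign (symmDiff R Q) * loopSign (symmDiff (symmDiff R Q) T))

/-- A family of unitaries whose exchange phases with all regions are those of the loop
superposition preserves the states of monomial operators. -/
theorem eventually_finiteState_conj {ι : Type} (U : Finset ι → unitary Obs)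
    (ρ : ι → Finset Edge → ℂ) (supp : ι → Finset Edge) (T : Finset ι → Finset Edge)
    (T' : Set Edge) (hU : ∀ F, ActsAs ((U F : Obs) : Op) (fun C => ∏ i ∈ F, ρ i C) (T F))
    (hρ0 : ∀ i C, ρ i C ≠ 0)
    (hρ : ∀ i C D, (∀ e ∈ supp i, e ∈ C ↔ e ∈ D) → ρ i C = ρ i D)
    (hsupp : ∀ e, {i | e ∈ supp i}.Finite)
    (hT : ∀ e, ∀ᶠ F in atTop, e ∈ T F ↔ e ∈ T')
    (hQ : ∀ (S : Finset Hexagon) (E : Finset Edge), ∃ Q : Finset Hexagon,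
      (∀ e ∈ E, e ∈ boundary Q ↔ e ∈ T') ∧ ∀ R,
        ∏ᶠ i, ρ i (symmDiff (boundary R) (boundary S)) / ρ i (boundary R) = exchangeSign Q S R)
    (O : Obs) (hO : IsMonomial (O : Op)) :
    ∀ᶠ F in atTop, ∀ᶠ Λ in atTop,
      finiteState Λ (Unitary.conjStarAlgAut ℂ Obs (U F) O) = finiteState Λ O := by
  classical
  obtain ⟨g, A, ⟨Eg, hEg⟩, hO⟩ := hO
  have hprod0 : ∀ (F : Finset ι) C, ∏ i ∈ F, ρ i C ≠ 0 := fun F C =>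
    Finset.prod_ne_zero_iff.2 fun i _ => hρ0 i C
  by_cases hA : ∃ S, A = boundary S
  swap
  · push Not at hA
    refine Eventually.of_forall fun F => Eventually.of_forall fun Λ => ?_
    rw [finiteState_of_not_boundary hO hA,
      finiteState_of_not_boundary ((hU F).conj (hprod0 F) hO) hA]
  obtain ⟨S, rfl⟩ := hA
  set A := boundary S
  -- Only finitely many factors of the string depend on an edge that `O` flips; all the others
  -- cancel in the ratio of phases.
  have hJ : {i | ∃ e ∈ A, e ∈ supp i}.Finite := by
    have : {i | ∃ e ∈ A, e ∈ supp i} = ⋃ e ∈ (A : Set Edge), {i | e ∈ supp i} := by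
      ext i; simp
    rw [this]
    exact A.finite_toSet.biUnion fun e _ => hsupp e
  set J := hJ.toFinset with hJdef
  have hone : ∀ i, i ∉ J → ∀ C, ρ i (symmDiff C A) / ρ i C = 1 := by
    intro i hi C
    rw [hρ i (symmDiff C A) C, div_self (hρ0 i C)]
    intro e he
    have : e ∉ A := fun h => hi (by rw [hJdef, Set.Finite.mem_toFinset]; exact ⟨e, h, he⟩)
    simp [Finset.mem_symmDiff, this]
  -- `E` collects the edges seen by these factors and by `g`. The region `Q` depends on `S` and `E`
  -- only, so `F` can be taken large first and `Λ` afterwards.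
  set E := J.biUnion supp ∪ Eg
  obtain ⟨Q, hQE, hQR⟩ := hQ S E
  have hTE : ∀ᶠ F in atTop, ∀ e ∈ E, e ∈ T F ↔ e ∈ T' :=
    (Filter.eventually_all_finset E).2 fun e _ => hT e
  filter_upwards [hTE, eventually_ge_atTop J] with F hF hJF
  filter_upwards [eventually_ge_atTop S, eventually_ge_atTop Q] with Λ hSΛ hQΛ
  rw [finiteState_of_boundary hO hSΛ, finiteState_of_boundary ((hU F).conj (hprod0 F) hO) hSΛ,
    -- Averaging over `R △ Q` instead of `R` compensates the flip by `T F` on the edges of `E`.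
    sum_powerset_symmDiff hQΛ]
  congr 1
  ext R
  set C := symmDiff (boundary (symmDiff R Q)) (T F)
  have hC : ∀ e ∈ E, e ∈ C ↔ e ∈ boundary R := by
    intro e he
    have h1 := hF e he
    have h2 := hQE e he
    simp only [C, boundary_symmDiff, Finset.mem_symmDiff]
    tauto
  -- `C` need not be a boundary. From here on only its agreement with `boundary R` on `E` is used.
  clear_value C
  have hg : g C = g (boundary R) :=
    hEg _ _ fun e he => hC e (Finset.mem_union_right _ he)
  have hratio : (∏ i ∈ F, ρ i (symmDiff C A)) / ∏ i ∈ F, ρ i C = exchangeSign Q S R := by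
    rw [← hQR R, ← Finset.prod_div_distrib, ← Finset.prod_subset hJF fun i _ hi => hone i hi C,
      finprod_eq_prod_of_mulSupport_subset (s := J)]
    · refine Finset.prod_congr rfl fun i hi => ?_
      have h3 : ∀ e ∈ supp i, e ∈ C ↔ e ∈ boundary R := fun e he =>
        hC e (Finset.mem_union_left _ (Finset.mem_biUnion.2 ⟨i, hi, he⟩))
      rw [hρ i C _ h3, hρ i (symmDiff C A) (symmDiff (boundary R) A)]
      intro e he
      rw [Finset.mem_symmDiff, Finset.mem_symmDiff, h3 e he]
    · intro i hi
      by_contra h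
      exact hi (hone i h _)
  rw [hratio, hg, exchangeSign]
  linear_combination (g (boundary R) * loopSign R * loopSign (symmDiff R S) *
      loopSign (symmDiff R Q) * loopSign (symmDiff R Q)) *
      loopSign_mul_self (symmDiff (symmDiff R Q) S) +
    (g (boundary R) * loopSign R * loopSign (symmDiff R S)) * loopSign_mul_self (symmDiff R Q)

/-- If conjugation preserves the states of monomial operators, then the limiting automorphism
preserves the double semion state. -/
theorem doubleSemionState_conjLimit {ι : Type} (U : Finset ι → unitary Obs) (hU : Stabilizes U)
    (h : ∀ O : Obs, IsMonomial (O : Op) → ∀ᶠ F in atTop, ∀ᶠ Λ in atTop,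
      finiteState Λ (Unitary.conjStarAlgAut ℂ Obs (U F) O) = finiteState Λ O) (O : Obs) :
    doubleSemionState (conjLimit U O) = doubleSemionState O := by
  classical
  have hloc : ∀ O : Obs, IsLocal O → ∀ᶠ F in atTop,
      doubleSemionState (Unitary.conjStarAlgAut ℂ Obs (U F) O) = doubleSemionState O := by
    intro O hO
    refine local_induction (p := fun O => ∀ᶠ F in atTop,
      doubleSemionState (Unitary.conjStarAlgAut ℂ Obs (U F) O) = doubleSemionState O) ?_ ?_ ?_ O hO
    · intro O hO
      filter_upwards [h O hO] with F hF
      exact tendsto_nhds_unique (tendsto_finiteState_apply _)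
        ((tendsto_finiteState_apply O).congr' (hF.mono fun Λ h => h.symm))
    · intro O Q hO hQ
      filter_upwards [hO, hQ] with F h1 h2
      rw [map_add, map_add, map_add, h1, h2]
    · intro c O hO
      filter_upwards [hO] with F h1
      rw [map_smul, map_smul, map_smul, h1]
  have hcont : Continuous fun O => doubleSemionState O :=
    (WeakDual.toStrongDual doubleSemionState).continuous
  have hlocal : ∀ O : Obs, IsLocal O →
      doubleSemionState (conjLimit U O) = doubleSemionState O := fun O hO => by
    refine tendsto_nhds_unique ((hcont.tendsto _).comp (hU.tendsto O)) ?_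
    exact tendsto_const_nhds.congr' ((hloc O hO).mono fun F h => h.symm)
  -- The limiting map is an isometry, so equality on the dense set of local observables extends to
  -- all of them.
  have hnorm : ∀ O, ‖conjLimit U O‖ = ‖O‖ := fun O =>
    tendsto_nhds_unique (hU.tendsto O).norm
      (tendsto_const_nhds.congr fun F => (norm_conj (U F) O).symm)
  have hsub : ∀ O Q, conjLimit U (O - Q) = conjLimit U O - conjLimit U Q := fun O Q => by
    refine tendsto_nhds_unique (hU.tendsto (O - Q)) ?_
    simpa only [map_sub] using (hU.tendsto O).sub (hU.tendsto Q)
  have hcont' : Continuous (conjLimit U) := by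
    refine (Isometry.of_dist_eq fun O Q => ?_).continuous
    rw [dist_eq_norm, dist_eq_norm, ← hsub, hnorm]
  exact congrFun (Continuous.ext_on dense_local (hcont.comp hcont') hcont hlocal) O

/-! ### String operators as monomial operators -/

/-- Unitary quasi-local observables as bounded operators. -/
noncomputable def unitaryHom : unitary Obs →* Op := obsHom.comp (unitary Obs).subtype

theorem actsAs_projPow_occupied (u : ℂ) (x : Edge) :
    ActsAs (projPow u (occupied x) : Op) (fun C => if x ∈ C then u else 1) ∅ := by
  intro C
  have h : symmDiff C ∅ = C := symmDiff_bot C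
  change (1 + (u - 1) • (1 / 2 : ℂ) • (1 - opZ x) : Op) (ket C) = _
  have hZ := actsAs_opZ x C
  rw [h] at hZ ⊢
  simp only [add_apply, smul_apply,
    sub_apply, one_apply_eq_self, hZ]
  by_cases hx : x ∈ C <;> simp only [hx, if_true, if_false] <;> module

theorem actsAs_cornerProj (j k : Edge) :
    ActsAs (projPow (-1) (cornerProj j k) : Op) (fun C => if j ∈ C ∧ k ∉ C then -1 else 1) ∅ := by
  intro C
  have h : symmDiff C ∅ = C := symmDiff_bot C
  change (1 + ((-1 : ℂ) - 1) • (1 / 4 : ℂ) • ((1 - opZ j) * (1 + opZ k)) : Op) (ket C) = _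
  have hj := actsAs_opZ j C
  have hk := actsAs_opZ k C
  rw [h] at hj hk ⊢
  simp only [add_apply, smul_apply, mul_apply_eq_comp,
    sub_apply, one_apply_eq_self, hk, map_add, map_smul, hj]
  by_cases h1 : j ∈ C <;> by_cases h2 : k ∈ C <;>
    simp only [h1, h2, if_true, if_false, not_true, not_false_iff, and_true, and_false, and_self] <;> module

/-- The legs of the hexagons of `S`. -/
def regionLegs (S : Finset Hexagon) : Finset Edge :=
  S.biUnion fun h => Finset.univ.image (hexLeg h)

namespace ClosedPath

variable {n : ℕ} (P : ClosedPath n)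

theorem actsAs_flipProd (F : Finset (ZMod n)) :
    ActsAs ((P.flipProd F : Obs) : Op) (fun _ => 1) (F.image P.edge) := by
  classical
  refine ActsAs.noncommProd_flip unitaryHom P.flipFactor (fun i => {P.edge i})
    (fun s => s.image P.edge) (fun i => actsAs_opX _) (by simp) (fun i s hi => ?_) F _
  rw [Finset.image_insert, symmDiff_singleton_of_notMem]
  rw [Finset.mem_image]
  rintro ⟨j, hj, h⟩
  exact hi (P.edge_injective' h ▸ hj)

theorem actsAs_legFactor (f : Edge → unitary Obs) (w : ℂ)
    (hf : ∀ x, ActsAs ((f x : Obs) : Op) (fun C => if x ∈ C then w else 1) ∅) (i : ZMod n) :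
    ActsAs ((P.legFactor f i : Obs) : Op)
      (fun C => if P.IsRight i ∧ P.leg i ∈ C then w else 1) ∅ := by
  unfold legFactor
  by_cases h : P.IsRight i
  · simpa only [h, if_true, true_and] using hf (P.leg i)
  · simp only [h, if_false, false_and]
    exact ActsAs.one

theorem actsAs_cornerFactor (i : ZMod n) :
    ActsAs ((P.cornerFactor i : Obs) : Op)
      (fun C => if P.IsLeft i ∧ P.edge (i - 1) ∈ C ∧ P.edge i ∉ C then -1 else 1) ∅ := by
  unfold cornerFactor
  by_cases h : P.IsLeft i
  · simp only [h, if_true, true_and]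
    exact actsAs_cornerProj (P.edge (i - 1)) (P.edge i)
  · simp only [h, if_false, false_and]
    exact ActsAs.one

/-- The string operator of type `S` or `S̄` is monomial. -/
theorem actsAs_semionString (u : unitary ℂ) (F : Finset (ZMod n)) :
    ActsAs ((P.flipProd F * P.legPhaseProd u F * P.cornerProd F : unitary Obs) : Op)
      (fun C => ∏ i ∈ F, P.vertexPhase u i C) (F.image P.edge) := by
  classical
  have h1 := P.actsAs_flipProd F
  have h2 : ActsAs ((P.legPhaseProd u F : Obs) : Op) _ ∅ :=
    ActsAs.noncommProd_phase unitaryHom (P.legFactor (unitPhase u)) _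
      (P.actsAs_legFactor (unitPhase u) u fun x => actsAs_projPow_occupied u x) F
      (fun i _ j _ _ => P.legFactor_commute (unitPhase u) (unitPhase_commute u) i j)
  have h3 : ActsAs ((P.cornerProd F : Obs) : Op) _ ∅ :=
    ActsAs.noncommProd_phase unitaryHom P.cornerFactor _ P.actsAs_cornerFactor F
      (fun i _ j _ _ => P.cornerFactor_commute i j)
  have hbot : ∀ C : Finset Edge, symmDiff C ∅ = C := symmDiff_bot
  -- The diagonal factors stand to the right of the flips, so their phases are evaluated on `C`
  -- before it is flipped.
  have h4 := (h1.mul h2).mul h3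
  simp only [hbot, mul_one, ← Finset.prod_mul_distrib] at h4
  intro C
  refine (h4 C).trans ?_
  simp only [vertexPhase, mul_comm]

/-- The string operator of type `B` is monomial. -/
theorem actsAs_legSignProd (F : Finset (ZMod n)) :
    ActsAs ((P.legSignProd F : Obs) : Op)
      (fun C => ∏ i ∈ F, if P.IsRight i ∧ P.leg i ∈ C then -1 else 1) ∅ := by
  classical
  exact ActsAs.noncommProd_phase unitaryHom (P.legFactor unitZ) _
    (P.actsAs_legFactor unitZ (-1) actsAs_opZ) F
    (fun i _ j _ _ => P.legFactor_commute unitZ unitZ_commute i j)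

/-- The edges on which the phase at the vertex with index `i` depends. -/
def phaseSupport (i : ZMod n) : Finset Edge := {P.leg i, P.edge (i - 1), P.edge i}

theorem vertexPhase_congr (u : ℂ) (i : ZMod n) {C D : Finset Edge}
    (h : ∀ e ∈ P.phaseSupport i, e ∈ C ↔ e ∈ D) : P.vertexPhase u i C = P.vertexPhase u i D := by
  have h1 := h (P.leg i) (by simp [phaseSupport])
  have h2 := h (P.edge (i - 1)) (by simp [phaseSupport])
  have h3 := h (P.edge i) (by simp [phaseSupport])
  simp only [vertexPhase, h1, h2, h3]

theorem finite_mem_phaseSupport (e : Edge) : {i | e ∈ P.phaseSupport i}.Finite := by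
  refine ((P.finite_leg e).union ((P.finite_edge_pred e).union (P.finite_edge e))).subset
    fun i hi => ?_
  have hi' : e = P.leg i ∨ e = P.edge (i - 1) ∨ e = P.edge i := by
    simpa [phaseSupport] using hi
  rcases hi' with h | h | h
  · exact Or.inl h.symm
  · exact Or.inr (Or.inl h.symm)
  · exact Or.inr (Or.inr h.symm)

theorem finite_mulSupport_vertexPhase {u : ℂ} (hu : u ≠ 0) (A C : Finset Edge) :
    (Function.mulSupport fun i =>
      P.vertexPhase u i (symmDiff C A) / P.vertexPhase u i C).Finite := by
  refine (A.finite_toSet.biUnion fun e _ => P.finite_mem_phaseSupport e).subset fun i hi => ?_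
  by_contra h
  simp only [Set.mem_iUnion, not_exists] at h
  refine hi ?_
  change P.vertexPhase u i (symmDiff C A) / P.vertexPhase u i C = 1
  rw [P.vertexPhase_congr u i (C := symmDiff C A) (D := C), div_self (P.vertexPhase_ne_zero hu i C)]
  intro e he
  have : e ∉ A := fun h' => h e h' he
  simp [Finset.mem_symmDiff, this]

/-! ### Exchange phases and invariance under string automorphisms -/

/-- The exchange phase of the path with a region is that of the loop superposition. -/
theorem finprod_vertexPhase_boundary {u : ℂ} (hu : u * u = -1) (Q S R : Finset Hexagon)
    (hQ : ∀ h ∈ S, ∀ k, hexLeg h k ∈ boundary Q ↔ hexLeg h k ∈ Set.range P.edge) :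
    ∏ᶠ i, P.vertexPhase u i (symmDiff (boundary R) (boundary S)) / P.vertexPhase u i (boundary R) =
      exchangeSign Q S R := by
  have hu0 : u ≠ 0 := by rintro rfl; simp at hu
  have hbot : ∀ C : Finset Hexagon, symmDiff C ∅ = C := symmDiff_bot
  induction S using Finset.induction_on with
  | empty =>
    have hbot' : ∀ C : Finset Edge, symmDiff C ∅ = C := symmDiff_bot
    simp only [boundary_empty, exchangeSign, hbot, hbot', loopSign_mul_self, mul_one]
    exact finprod_eq_one_of_forall_eq_one fun i => div_self (P.vertexPhase_ne_zero hu0 _ _)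
  | insert h S hS ih =>
    have ih := ih fun k hk => hQ k (Finset.mem_insert_of_mem hk)
    -- The last hexagon is exchanged in the presence of the earlier ones: the configuration is `∂(R
    -- △ S)`, and on the legs of `h` the flip along the path is the flip by `∂Q`.
    have hstep := P.finprod_vertexPhase hu h (boundary (symmDiff R S))
      (boundary (symmDiff (symmDiff R Q) S)) (isClosedSet_boundary _) (by
        intro k
        have := hQ h (Finset.mem_insert_self h S) k
        simp only [boundary_symmDiff, Finset.mem_symmDiff]
        tauto)
    have hsplit : ∀ i, P.vertexPhase u i (symmDiff (boundary R) (boundary (insert h S))) /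
        P.vertexPhase u i (boundary R) =
        P.vertexPhase u i (symmDiff (boundary (symmDiff R S)) (hexEdges h)) /
          P.vertexPhase u i (boundary (symmDiff R S)) *
        (P.vertexPhase u i (symmDiff (boundary R) (boundary S)) /
          P.vertexPhase u i (boundary R)) := by
      intro i
      rw [← symmDiff_singleton_of_notMem hS, boundary_symmDiff S, boundary_singleton,
        boundary_symmDiff R S, symmDiff_assoc,
        div_mul_div_cancel₀ (P.vertexPhase_ne_zero hu0 _ _)]
    rw [finprod_congr hsplit, finprod_mul_distrib (P.finite_mulSupport_vertexPhase hu0 _ _)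
      (P.finite_mulSupport_vertexPhase hu0 _ _), ih]
    have h1 := hexPhase_boundary_mul_self hu h (symmDiff R S)
    simp only [exchangeSign]
    rw [← symmDiff_singleton_of_notMem hS, ← symmDiff_assoc, ← symmDiff_assoc,
      loopSign_symmDiff hu (symmDiff R S), loopSign_symmDiff hu (symmDiff (symmDiff R Q) S),
      ← hstep]
    linear_combination (-(∏ᶠ i, P.vertexPhase u i
      (symmDiff (boundary (symmDiff R S)) (hexEdges h)) /
        P.vertexPhase u i (boundary (symmDiff R S))) * loopSign R * loopSign (symmDiff R S) *
      loopSign (symmDiff R Q) * loopSign (symmDiff (symmDiff R Q) S)) * h1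

/-- The region `Q` has to match the path on the legs of `S` too, where the hexagon phases are read.
It does not depend on `u`; the case of `B` relies on this to compare `u = i` with `u = -i`. -/
theorem exists_exchangeSign (S : Finset Hexagon) (E : Finset Edge) : ∃ Q : Finset Hexagon,
    (∀ e ∈ E, e ∈ boundary Q ↔ e ∈ Set.range P.edge) ∧ ∀ u : ℂ, u * u = -1 → ∀ R,
      ∏ᶠ i, P.vertexPhase u i (symmDiff (boundary R) (boundary S)) /
        P.vertexPhase u i (boundary R) = exchangeSign Q S R := by
  obtain ⟨Q, hQ⟩ := exists_boundary_eqOn _ P.indicator_range_edge (E ∪ regionLegs S)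
  refine ⟨Q, fun e he => hQ e (Finset.mem_union_left _ he), fun u hu R =>
    P.finprod_vertexPhase_boundary hu Q S R fun h hh k => hQ _ (Finset.mem_union_right _ ?_)⟩
  exact Finset.mem_biUnion.2 ⟨h, hh, Finset.mem_image.2 ⟨k, Finset.mem_univ _, rfl⟩⟩

theorem eventually_mem_image_edge (e : Edge) :
    ∀ᶠ F : Finset (ZMod n) in atTop, e ∈ F.image P.edge ↔ e ∈ Set.range P.edge := by
  by_cases he : e ∈ Set.range P.edge
  · obtain ⟨i, rfl⟩ := he
    filter_upwards [eventually_ge_atTop {i}] with F hF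
    simp only [Set.mem_range_self, iff_true]
    exact Finset.mem_image_of_mem _ (hF (Finset.mem_singleton_self i))
  · refine Eventually.of_forall fun F => iff_of_false (fun h => he ?_) he
    obtain ⟨i, -, hi⟩ := Finset.mem_image.1 h
    exact ⟨i, hi⟩

theorem eventually_finiteState_conj_semionString (u : unitary ℂ) (hu : (u : ℂ) * u = -1) (O : Obs)
    (hO : IsMonomial (O : Op)) : ∀ᶠ F in atTop, ∀ᶠ Λ in atTop,
      finiteState Λ (Unitary.conjStarAlgAut ℂ Obs
        (P.flipProd F * P.legPhaseProd u F * P.cornerProd F) O) = finiteState Λ O := by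
  have hu0 : (u : ℂ) ≠ 0 := by intro h; simp [h] at hu
  refine eventually_finiteState_conj _ (fun i => P.vertexPhase u i) P.phaseSupport
    (fun F => F.image P.edge) (Set.range P.edge) (P.actsAs_semionString u)
    (fun i C => P.vertexPhase_ne_zero hu0 i C) (fun i C D => P.vertexPhase_congr u i)
    P.finite_mem_phaseSupport P.eventually_mem_image_edge (fun S E => ?_) O hO
  obtain ⟨Q, h1, h2⟩ := P.exists_exchangeSign S E
  exact ⟨Q, h1, h2 u hu⟩

/-- The factor of `B` at a vertex is the quotient of those for `u = i` and `u = -i`, since `i / (-i)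
= -1` and the corner signs cancel. Both exchange phases equal the same `exchangeSign Q S R`, so that
of `B` is `1`, which is the exchange sign of the empty region. No edge is flipped. -/
theorem eventually_finiteState_conj_legSign (O : Obs) (hO : IsMonomial (O : Op)) :
    ∀ᶠ F in atTop, ∀ᶠ Λ in atTop,
      finiteState Λ (Unitary.conjStarAlgAut ℂ Obs (P.legSignProd F) O) = finiteState Λ O := by
  have hdiv : ∀ i C, (if P.IsRight i ∧ P.leg i ∈ C then (-1 : ℂ) else 1) =
      P.vertexPhase Complex.I i C / P.vertexPhase (-Complex.I) i C := fun i C => by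
    unfold vertexPhase
    split_ifs <;> simp
  have hI0 := Complex.I_ne_zero
  refine eventually_finiteState_conj _ (fun i C => if P.IsRight i ∧ P.leg i ∈ C then -1 else 1)
    P.phaseSupport (fun _ => ∅) ∅ P.actsAs_legSignProd (fun i C => by split_ifs <;> simp)
    (fun i C D h => ?_) P.finite_mem_phaseSupport
    (fun e => Eventually.of_forall fun F => by simp) (fun S E => ⟨∅, ?_, fun R => ?_⟩) O hO
  · rw [hdiv, hdiv, P.vertexPhase_congr _ i h, P.vertexPhase_congr _ i h]
  · simp [boundary_empty]
  · obtain ⟨Q, -, hQ⟩ := P.exists_exchangeSign S ∅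
    have h1 := hQ Complex.I Complex.I_mul_I R
    have h2 := hQ (-Complex.I) (by simp) R
    have hbot : ∀ C : Finset Hexagon, symmDiff C ∅ = C := symmDiff_bot
    have h3 : exchangeSign ∅ S R = 1 := by
      rw [exchangeSign, hbot]
      linear_combination (loopSign (symmDiff R S) * loopSign (symmDiff R S)) *
        loopSign_mul_self R + loopSign_mul_self (symmDiff R S)
    have h4 : exchangeSign Q S R ≠ 0 := by
      have hne : ∀ R, loopSign R ≠ 0 := fun R h => by simpa [h] using loopSign_mul_self R
      simp [exchangeSign, hne]
    have h5 := div_self h4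
    nth_rewrite 1 [← h1] at h5
    rw [← h2, ← finprod_div_distrib (P.finite_mulSupport_vertexPhase hI0 _ _)
      (P.finite_mulSupport_vertexPhase (neg_ne_zero.2 hI0) _ _)] at h5
    rw [h3]
    refine (finprod_congr fun i => ?_).trans h5
    rw [hdiv, hdiv, div_div_div_comm]

theorem doubleSemionState_stringAut (a : Label) (O : Obs) :
    doubleSemionState (P.stringAut a O) = doubleSemionState O := by
  refine doubleSemionState_conjLimit _ (P.stabilizes_stringOp a).1 (fun O hO => ?_) O
  cases a with
  | vacuum =>
    refine Eventually.of_forall fun F => Eventually.of_forall fun Λ => ?_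
    simp [stringOp]
  | semion =>
    exact P.eventually_finiteState_conj_semionString phaseI Complex.I_mul_I O hO
  | antisemion =>
    exact P.eventually_finiteState_conj_semionString (star phaseI) (by simp [phaseI]) O hO
  | boundState => exact P.eventually_finiteState_conj_legSign O hO

end ClosedPath

end DoubleSemion

theorem mainTheorem8 :
    (∀ Λ : ℕ → Finset DoubleSemion.Hexagon, Monotone Λ → (∀ h, ∃ k, h ∈ Λ k) →
      Filter.Tendsto (fun k => DoubleSemion.finiteState (Λ k)) Filter.atTop
        (nhds DoubleSemion.doubleSemionState)) ∧
    ∀ (n : ℕ) (P : DoubleSemion.ClosedPath n) (a : DoubleSemion.Label) (O : DoubleSemion.Obs),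
      DoubleSemion.doubleSemionState (P.stringAut a O) = DoubleSemion.doubleSemionState O :=
  -- An exhausting increasing sequence is eventually above every finite set of hexagons, so
  -- convergence along the net of all finite sets implies convergence along it.
  ⟨fun _ hmono hΛ => DoubleSemion.tendsto_finiteState.comp
    (Filter.tendsto_atTop_finset_of_monotone hmono hΛ),
    fun _ P a O => P.doubleSemionState_stringAut a O⟩
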